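/- Let $\varphi_0,\varphi_1,\dots$ be the standard enumeration of the partial computable functions from $\omega$ to $\omega$, and let $\emptyset'=\{i:\varphi_i(i)\text{ is defined}\}$. If $\varphi_i$ is total and is the characteristic function of a set, that set is denoted by $C_i$. If $\varphi_e$ is total and is the characteristic function of (the set of Gödel numbers of) the atomic diagram of an abelian group whose universe is a subset of $\omega$, that group is denoted by $\mathcal G_e$. Call $(e,a,b,g,h,r)\in\omega^6$ an *input for* $(E;A,B,G,H)$ if $\mathcal G_e$ is the abelian group $E$; the sets $C_a,C_b,C_g,C_h$ are the underlying sets of subgroups $A,B,G,H$ of $E$; $E=A\oplus G=B\oplus H$ as internal direct sums; and $A$ and $B$ are isomorphic and finitely generated of rank $r$, where the rank of an abelian group is the cardinality of a maximal $\mathbb Z$-linearly independent subset. **Theorem.** 1. There is a partial function $F$ from $\omega^6$ to $\omega$, partial computable relative to $\emptyset'$, such that whenever $(e,a,b,g,h,r)$ is an input for $(E;A,B,G,H)$, the value $F(e,a,b,g,h,r)$ is defined and $\varphi_{F(e,a,b,g,h,r)}$ is an isomorphism from $G$ to $H$ (with domain exactly $G$). 2. Let $F$ be any partial function from $\omega^6$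 to $\omega$ (in particular, $F$ may be total) such that whenever $(e,a,b,g,h,r)$ is an input for $(E;A,B,G,H)$, the value $F(e,a,b,g,h,r)$ is defined and $\varphi_{F(e,a,b,g,h,r)}$ restricts to an isomorphism from $G$ to $H$. Then $\emptyset'\le_T F$, that is, the characteristic function of $\emptyset'$ is partial computable relative to $F$. Hence the degree of uniformity is exactly $\mathbf 0'$. -/

import Mathlib

noncomputable section

/-- The partial computable function `φ_i` with index `i`, in the standard numbering of Mathlib. -/
def phi (i : ℕ) : ℕ →. ℕ := Nat.Partrec.Code.eval (Denumerable.ofNat Nat.Partrec.Code i)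

open Classical in
/-- The characteristic function of a set of natural numbers. -/
def charFun (S : Set ℕ) (n : ℕ) : ℕ := if n ∈ S then 1 else 0

/-- `S = C_i`: the function `φ_i` is total and is the characteristic function of `S`. -/
def IsSetIndex (i : ℕ) (S : Set ℕ) : Prop := ∀ n, phi i n = Part.some (charFun S n)

/-- The halting set `∅' = {i : φ_i(i) is defined}`. -/
def haltingSet : Set ℕ := {i | (phi i i).Dom}

/-- The (total) characteristic function of `∅'`, in the form in which it serves as an oracle. -/
def zeroJump : ℕ →. ℕ := fun n => Part.some (charFun haltingSet n)

/-- The atomic diagram of a group whose universe is a set `E` of natural numbers, as a set of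
Gödel numbers: `2⟨x, y⟩` is the Gödel number of the sentence `x = y`, and `2⟨⟨x, y⟩, z⟩ + 1` is the
Gödel number of the sentence `x + y = z`. The universe is read off from the sentences `x = x`. -/
def atomicDiagram (E : Set ℕ) [AddCommGroup E] : Set ℕ :=
  {n | (∃ x : E, n = 2 * Nat.pair x x) ∨
    ∃ x y : E, n = 2 * Nat.pair (Nat.pair x y) ((x + y : E) : ℕ) + 1}

/-- `𝒢_e` is the computable abelian group `E`: the function `φ_e` decides its atomic diagram. -/
def IsGroupIndex (e : ℕ) (E : Set ℕ) [AddCommGroup E] : Prop := IsSetIndex e (atomicDiagram E)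

/-- The set of natural numbers that underlies a subgroup of `E`. -/
def underlying {E : Set ℕ} [AddCommGroup E] (S : AddSubgroup E) : Set ℕ :=
  {n | ∃ x : E, x ∈ S ∧ (x : ℕ) = n}

/-- The inputs at issue: `𝒢_e` is the abelian group `E`, the computable sets `C_a, C_b, C_g, C_h` are
its subgroups `A, B, G, H`, there are internal direct sums `E = A ⊕ G = B ⊕ H`, and `A`, `B` are
isomorphic and finitely generated of rank `r` (the rank of an abelian group being the maximal
number of elements that are linearly independent over the integers). -/
structure IsInput (e a b g h r : ℕ) (E : Set ℕ) [AddCommGroup E] (A B G H : AddSubgroup E) :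
    Prop where
  group : IsGroupIndex e E
  setA : IsSetIndex a (underlying A)
  setB : IsSetIndex b (underlying B)
  setG : IsSetIndex g (underlying G)
  setH : IsSetIndex h (underlying H)
  sumAG : IsCompl A G
  sumBH : IsCompl B H
  iso : Nonempty (A ≃+ B)
  fg : AddGroup.FG A
  rank : Module.finrank ℤ A = r

/-- `φ_i` is an isomorphism from `G` to `H`: as a partial function on the natural numbers it has
domain exactly `G`, and it is an isomorphism of groups there. -/
def IsIsoIndex {E : Set ℕ} [AddCommGroup E] (i : ℕ) (G H : AddSubgroup E) : Prop :=
  ∃ f : G ≃+ H, ∀ n m : ℕ, m ∈ phi i n ↔ ∃ x : G, ((x : E) : ℕ) = n ∧ ((f x : E) : ℕ) = m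

/-- `φ_i` restricts to an isomorphism from `G` to `H`; its values outside `G` do not matter. -/
def IsIsoIndexOn {E : Set ℕ} [AddCommGroup E] (i : ℕ) (G H : AddSubgroup E) : Prop :=
  ∃ f : G ≃+ H, ∀ x : G, phi i ((x : E) : ℕ) = Part.some ((f x : E) : ℕ)

/-- The bijective coding of six natural numbers by one, through which a partial function of six
arguments is regarded as a partial function of one argument. -/
def code6 (e a b g h r : ℕ) : ℕ :=
  Nat.pair e (Nat.pair a (Nat.pair b (Nat.pair g (Nat.pair h r))))

end

/-! Upper bound. Finitely generated abelian groups cancel from direct sums, and the isomorphism `f :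
G ≃+ H` can be chosen to be the identity on `G ∩ H` (`exists_equiv_of_isCompl_of_fg`). By the
structure theorem it suffices to cancel `ℤ` and `ZMod (p ^ k)`. In each case either the component `G
→ H` of the given isomorphism is bijective, or the cyclic group splits off from both `G` and `H`
with complements that the given isomorphism identifies.

Since `G / (G ∩ H)` embeds in `E / H ≅ B`, it is finitely generated, so such an `f` is determined by
finitely many values `g k ↦ h k`: it sends `x` to `x - ∑ z k • g k + ∑ z k • h k` whenever `x - ∑ z
k • g k ∈ H`. It remains to find good `g`, `h` with the oracle `∅'`, that is, to recognize them by a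
condition whose failure is recursively enumerable. Agreement of the two combinations when the first
lies in `H` is such a condition, but "the `g k` generate `G` modulo `H`" has the form "for all,
there is". The rank `r` removes the inner unbounded quantifier. If `b` consists of `r` independent
elements of `B`, every `x` satisfies a relation `n • x ≡ ∑ y j • b j` modulo `H` with `n ≥ 1`. For
well chosen `g` and `b` the free coordinates of `x` are the quotients `y j / n`, and the remaining
torsion part takes finitely many values, so a bounded search suffices. This is the certificate
`HalfCert`. `exists_halfCert` shows that certificates exist, `HalfCert.exists_addEquiv` that a pair
of them yields an isomorphism, and `rePred_fails` that wrong ones can be refuted effectively. The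
oracle finds the first data that are not refuted.

Lower bound. For each `i` there is a computable copy of `ℤ × d ℤ`, uniformly in `i`, where `d` is
`1` if `i ∈ ∅'` and `2` otherwise: a name with odd second coordinate has to include the halting time
of `φ_i(i)`. An isomorphism from the first factor to the second sends `(1, 0)` to `(0, ± d)`, and
the parity of `d` decides `i ∈ ∅'`. -/

section Computability

/-! ### Recursively enumerable predicates and their reduction to the halting set. -/

variable {α β : Type*} [Primcodable α] [Primcodable β]

theorem partrec₂_phi : Partrec₂ phi :=
  Nat.Partrec.Code.eval_part.comp₂ ((Computable.ofNat Nat.Partrec.Code).comp Computable.fst).to₂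
    Computable.snd.to₂

/-- The parametrization theorem. -/
theorem exists_computable_index {f : α → ℕ →. ℕ} (hf : Partrec₂ f) :
    ∃ s : α → ℕ, Computable s ∧ ∀ a n, phi (s a) n = f a n := by
  have h1 : Nat.Partrec fun n => (Part.bind (Encodable.decode (α := α) n.unpair.1 : Part α)
      fun a => f a n.unpair.2) := by
    refine Partrec.nat_iff.1 (Partrec.bind (g := fun n a => f a n.unpair.2) ((Computable.decode.comp
      (Computable.fst.comp Computable.unpair)).ofOption) ?_)
    exact hf.comp Computable.snd (Computable.snd.comp (Computable.unpair.comp Computable.fst))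
  obtain ⟨c, hc⟩ := Nat.Partrec.Code.exists_code.1 h1
  refine ⟨fun a => Encodable.encode (c.curry (Encodable.encode a)), ?_, ?_⟩
  · exact Computable.encode.comp ((Nat.Partrec.Code.primrec₂_curry.to_comp).comp
      (Computable.const c) Computable.encode)
  · intro a n
    simp [phi, Nat.Partrec.Code.eval_curry, hc]

namespace REPred

theorem exists_partrec {p : α → Prop} (hp : REPred p) :
    ∃ f : α →. Unit, Partrec f ∧ ∀ a, (f a).Dom ↔ p a :=
  ⟨_, hp, fun a => by simp [Part.assert]⟩

theorem and {p q : α → Prop} (hp : REPred p) (hq : REPred q) : REPred fun a => p a ∧ q a := by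
  obtain ⟨f, hf, hfp⟩ := hp.exists_partrec
  obtain ⟨g, hg, hgq⟩ := hq.exists_partrec
  have := (hf.bind (hg.comp Computable.fst).to₂).dom_re
  refine this.of_eq fun a => ?_
  simp [Part.bind_dom, hfp, hgq]

theorem or {p q : α → Prop} (hp : REPred p) (hq : REPred q) : REPred fun a => p a ∨ q a := by
  obtain ⟨f, hf, hfp⟩ := hp.exists_partrec
  obtain ⟨g, hg, hgq⟩ := hq.exists_partrec
  obtain ⟨k, hk, H⟩ := Partrec.merge' hf hg
  exact hk.dom_re.of_eq fun a => by rw [(H a).2, hfp, hgq]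

/-- Dovetailing: the search runs over codes `w` of pairs consisting of a step bound and a candidate
witness. -/
theorem ex {p : α → β → Prop} (hp : REPred fun x : α × β => p x.1 x.2) :
    REPred fun a => ∃ b, p a b := by
  obtain ⟨c, hc⟩ := Nat.Partrec.Code.exists_code.1 hp
  have hc' : ∀ a n, (c.eval (Nat.pair (Encodable.encode a) n)).Dom ↔
      ∃ b, Encodable.decode (α := β) n = some b ∧ p a b := by
    intro a n
    rw [hc]
    cases h : Encodable.decode (α := β) n <;> simp [h, Part.assert]
  have hcomp : Computable₂ fun (a : α) (w : ℕ) =>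
      Nat.Partrec.Code.evaln w.unpair.1 c (Nat.pair (Encodable.encode a) w.unpair.2) := by
    refine Nat.Partrec.Code.primrec_evaln.to_comp.comp
      (Computable.pair (Computable.pair ?_ (Computable.const c)) ?_)
    · exact Computable.fst.comp (Computable.unpair.comp Computable.snd)
    · exact (Primrec₂.natPair.to_comp).comp (Computable.encode.comp Computable.fst)
        (Computable.snd.comp (Computable.unpair.comp Computable.snd))
  refine (Partrec.rfindOpt hcomp).dom_re.of_eq fun a => ?_
  rw [Nat.rfindOpt_dom]
  constructor
  · rintro ⟨w, v, hv⟩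
    have := Nat.Partrec.Code.evaln_sound hv
    obtain ⟨b, -, hb⟩ := (hc' a _).1 (Part.dom_iff_mem.2 ⟨_, this⟩)
    exact ⟨b, hb⟩
  · rintro ⟨b, hb⟩
    have := (hc' a (Encodable.encode b)).2 ⟨b, Encodable.encodek b, hb⟩
    obtain ⟨v, hv⟩ := Part.dom_iff_mem.1 this
    obtain ⟨k, hk⟩ := Nat.Partrec.Code.evaln_complete.1 hv
    exact ⟨Nat.pair k (Encodable.encode b), v, by simpa using hk⟩

theorem ball_lt {p : α → ℕ → Prop} (hp : REPred fun x : α × ℕ => p x.1 x.2)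
    {N : α → ℕ} (hN : Computable N) : REPred fun a => ∀ i < N a, p a i := by
  obtain ⟨f, hf, hfp⟩ := hp.exists_partrec
  have h : Partrec fun a => Nat.rec (motive := fun _ => Part Unit) (Part.some ())
      (fun i IH => IH.bind fun _ => f (a, i)) (N a) := by
    refine Partrec.nat_rec (h := fun a (q : ℕ × Unit) => f (a, q.1)) hN
      (Computable.const ()) ?_
    exact hf.comp (Computable.pair Computable.fst (Computable.fst.comp Computable.snd))
  refine h.dom_re.of_eq fun a => ?_
  generalize N a = n
  induction n with
  | zero => simp
  | succ n ih =>
    simp only [Part.bind_dom]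
    constructor
    · rintro ⟨h1, h2⟩ i hi
      rcases Nat.lt_succ_iff_lt_or_eq.1 hi with hi | rfl
      · exact ih.1 h1 i hi
      · exact (hfp _).1 h2
    · intro H
      exact ⟨ih.2 fun i hi => H i (hi.trans (Nat.lt_succ_self n)),
        (hfp _).2 (H n (Nat.lt_succ_self n))⟩

theorem mem {f : α →. β} (hf : Partrec f) {g : α → β} (hg : Computable g) :
    REPred fun a => g a ∈ f a := by
  classical
  have hd : Partrec fun a => (f a).bind fun b =>
      Part.ofOption (if b = g a then some () else none) := by
    refine hf.bind (Computable.ofOption ?_)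
    have : Computable fun p : α × β => decide (p.2 = g p.1) :=
      (Primrec.eq (α := β)).decide.to_comp.comp Computable.snd (hg.comp Computable.fst)
    exact (Computable.cond this (Computable.const (Option.some ()))
      (Computable.const Option.none)).of_eq fun p => by by_cases h : p.2 = g p.1 <;> simp [h]
  refine hd.dom_re.of_eq fun a => ?_
  constructor
  · intro h
    obtain ⟨u, hu⟩ := Part.dom_iff_mem.1 h
    obtain ⟨b, hb, hu⟩ := Part.mem_bind_iff.1 hu
    by_cases hbg : b = g a
    · exact hbg ▸ hb
    · simp [hbg] at hu
  · intro h
    exact Part.dom_iff_mem.2 ⟨(), Part.mem_bind_iff.2 ⟨g a, h, by simp⟩⟩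

end REPred

/-- The function with index `t a` semidecides `p a` and ignores its argument, so applying it to its
own index does no harm. -/
theorem exists_reduction_haltingSet {p : α → Prop} (hp : REPred p) :
    ∃ t : α → ℕ, Computable t ∧ ∀ a, p a ↔ t a ∈ haltingSet := by
  obtain ⟨f, hf, hfp⟩ := hp.exists_partrec
  have : Partrec₂ fun (a : α) (_ : ℕ) => (f a).map fun _ => 0 :=
    (hf.comp Computable.fst).map (Computable.const 0).to₂
  obtain ⟨t, ht, h⟩ := exists_computable_index this
  refine ⟨t, ht, fun a => ?_⟩
  simp [haltingSet, h, hfp]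

end Computability

/-! ### Cancellation of finitely generated direct summands. -/

section Cancellation

/-- Cancellation of `A` from direct sums, by an isomorphism that agrees with the given one on those
elements of the complement that the latter sends to the other complement. -/
def Cancellable (A : Type) [AddCommGroup A] : Prop :=
  ∀ (G H : Type) [AddCommGroup G] [AddCommGroup H] (e : A × G ≃+ A × H),
    ∃ f : G ≃+ H, ∀ x y, e (0, x) = (0, y) → f x = y

namespace Cancellable

variable {A B G H C : Type} [AddCommGroup A] [AddCommGroup B] [AddCommGroup G] [AddCommGroup H]
  [AddCommGroup C]

theorem of_equiv (i : A ≃+ B) (hA : Cancellable A) : Cancellable B := by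
  intro G H _ _ e
  obtain ⟨f, hf⟩ := hA G H
    (((i.prodCongr (AddEquiv.refl G)).trans e).trans (i.prodCongr (AddEquiv.refl H)).symm)
  refine ⟨f, fun x y h => hf x y ?_⟩
  simp [AddEquiv.prodCongr, h]

theorem of_subsingleton [Subsingleton A] : Cancellable A := by
  intro G H _ _ e
  have h0 : ∀ a b : A, a = b := fun a b => Subsingleton.elim a b
  refine ⟨⟨⟨fun x => (e (0, x)).2, fun y => (e.symm (0, y)).2, fun x => ?_, fun y => ?_⟩,
    fun x y => ?_⟩, fun x y h => ?_⟩
  · have : ((0 : A), (e (0, x)).2) = e (0, x) := Prod.ext (h0 _ _) rfl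
    simp [this]
  · have : ((0 : A), (e.symm (0, y)).2) = e.symm (0, y) := Prod.ext (h0 _ _) rfl
    simp [this]
  · have : ((0 : A), x + y) = (0, x) + (0, y) := by simp
    simp only [this, map_add, Prod.snd_add]
  · simp [h]

/-- Cancel one factor after the other. The agreement clause passes through because the first
isomorphism already sends `(0, x)` to `(0, y)`. -/
theorem prod (hA : Cancellable A) (hB : Cancellable B) : Cancellable (A × B) := by
  intro G H _ _ e
  obtain ⟨f, hf⟩ := hA (B × G) (B × H)
    (((AddEquiv.prodAssoc (M := A) (N := B) (P := G)).symm.trans e).trans AddEquiv.prodAssoc)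
  obtain ⟨f', hf'⟩ := hB G H f
  refine ⟨f', fun x y h => hf' x y (hf _ _ ?_)⟩
  have : e ((0, 0), x) = ((0, 0), y) := h
  simp [AddEquiv.prodAssoc, this]

theorem pi {ι : Type} [Finite ι] : ∀ (M : ι → Type) [∀ i, AddCommGroup (M i)],
    (∀ i, Cancellable (M i)) → Cancellable (∀ i, M i) := by
  induction ι using Finite.induction_empty_option with
  | of_equiv e ih =>
    intro M _ hM
    refine of_equiv (A := ∀ i, M (e i)) ?_ (ih (fun i => M (e i)) fun i => hM _)
    exact { Equiv.piCongrLeft M e with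
      map_add' := fun x y => by
        funext b
        obtain ⟨a, rfl⟩ := e.surjective b
        simp only [Equiv.toFun_as_coe, Pi.add_apply, Equiv.piCongrLeft_apply_apply] }
  | h_empty => intro M _ _; exact of_subsingleton
  | h_option ih =>
    intro M _ hM
    refine of_equiv (A := M none × ∀ i, M (some i)) ?_ ((hM none).prod (ih _ fun i => hM _))
    exact { (Equiv.piOptionEquivProd (β := M)).symm with
      map_add' := fun x y => by
        funext b
        cases b <;> rfl }

theorem exists_equiv_of_bijective (e : A × G ≃+ A × H)
    (h : Function.Bijective fun x : G => (e (0, x)).2) :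
    ∃ f : G ≃+ H, ∀ x y, e (0, x) = (0, y) → f x = y := by
  let β : G →+ H := ((AddMonoidHom.snd A H).comp e.toAddMonoidHom).comp (AddMonoidHom.inr A G)
  refine ⟨AddEquiv.ofBijective β h, fun x y hxy => ?_⟩
  simp [β, hxy]

/-- Here `G = ker q ⊕ s(C)` and `H = ker q' ⊕ s'(C)`. By `hq` and `hq'`, the kernels consist of the
elements that `e`, respectively its inverse, sends into the other complement, so `e` identifies
them. Gluing this with `s c ↦ s' c` gives `f`, which agrees with `e` on `ker q`. -/
theorem exists_equiv_of_retractions (e : A × G ≃+ A × H)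
    (q : G →+ C) (s : C →+ G) (hqs : ∀ c, q (s c) = c) (hq : ∀ x, q x = 0 ↔ (e (0, x)).1 = 0)
    (q' : H →+ C) (s' : C →+ H) (hqs' : ∀ c, q' (s' c) = c)
    (hq' : ∀ y, q' y = 0 ↔ (e.symm (0, y)).1 = 0) :
    ∃ f : G ≃+ H, ∀ x y, e (0, x) = (0, y) → f x = y := by
  let β : G →+ H := ((AddMonoidHom.snd A H).comp e.toAddMonoidHom).comp (AddMonoidHom.inr A G)
  let δ : H →+ G := ((AddMonoidHom.snd A G).comp e.symm.toAddMonoidHom).comp (AddMonoidHom.inr A H)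
  have hβ : ∀ x, q x = 0 → e (0, x) = (0, β x) := fun x hx =>
    Prod.ext ((hq x).1 hx) rfl
  have hδ : ∀ y, q' y = 0 → e.symm (0, y) = (0, δ y) := fun y hy =>
    Prod.ext ((hq' y).1 hy) rfl
  have hδβ : ∀ x, q x = 0 → q' (β x) = 0 ∧ δ (β x) = x := by
    intro x hx
    have h1 : e.symm (0, β x) = (0, x) := by rw [← hβ x hx, e.symm_apply_apply]
    have h2 : q' (β x) = 0 := (hq' _).2 (by rw [h1])
    refine ⟨h2, ?_⟩
    rw [hδ _ h2] at h1
    exact (Prod.ext_iff.1 h1).2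
  have hβδ : ∀ y, q' y = 0 → q (δ y) = 0 ∧ β (δ y) = y := by
    intro y hy
    have h1 : e (0, δ y) = (0, y) := by rw [← hδ y hy, e.apply_symm_apply]
    have h2 : q (δ y) = 0 := (hq _).2 (by rw [h1])
    refine ⟨h2, ?_⟩
    rw [hβ _ h2] at h1
    exact (Prod.ext_iff.1 h1).2
  let f : G →+ H := β.comp (AddMonoidHom.id G - s.comp q) + s'.comp q
  let f' : H →+ G := δ.comp (AddMonoidHom.id H - s'.comp q') + s.comp q'
  have hf : ∀ x, f x = β (x - s (q x)) + s' (q x) := fun x => rfl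
  have hf' : ∀ y, f' y = δ (y - s' (q' y)) + s (q' y) := fun y => rfl
  have e1 : ∀ x, f' (f x) = x := by
    intro x
    have h0 : q (x - s (q x)) = 0 := by simp [hqs]
    obtain ⟨h1, h2⟩ := hδβ _ h0
    have h3 : q' (f x) = q x := by rw [hf, map_add, h1, hqs', zero_add]
    rw [hf', h3, hf, add_sub_cancel_right, h2, sub_add_cancel]
  have e2 : ∀ y, f (f' y) = y := by
    intro y
    have h0 : q' (y - s' (q' y)) = 0 := by simp [hqs']
    obtain ⟨h1, h2⟩ := hβδ _ h0
    have h3 : q (f' y) = q' y := by rw [hf', map_add, h1, hqs, zero_add]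
    rw [hf, h3, hf', add_sub_cancel_right, h2, sub_add_cancel]
  refine ⟨{ f with toFun := f, invFun := f', left_inv := e1, right_inv := e2 }, fun x y h => ?_⟩
  have hx : q x = 0 := (hq x).2 (by rw [h])
  have : f x = y := by
    rw [hf, hx]
    simp [β, h]
  exact this

/-- The image of `α` is `m ℤ` with `m ≠ 0`. Division by `m` makes `α` surjective with the same
kernel, and a surjection onto `ℤ` splits. -/
theorem exists_retraction_int {α : G →+ ℤ} (hα : α ≠ 0) :
    ∃ (q : G →+ ℤ) (s : ℤ →+ G), (∀ c, q (s c) = c) ∧ ∀ x, q x = 0 ↔ α x = 0 := by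
  obtain ⟨m, hm⟩ := Int.subgroup_cyclic α.range
  have hm0 : m ≠ 0 := by
    rintro rfl
    apply hα
    ext x
    have : α x ∈ α.range := ⟨x, rfl⟩
    rw [hm, AddSubgroup.mem_closure_singleton] at this
    obtain ⟨n, hn⟩ := this
    simp [← hn]
  have hdvd : ∀ x, m ∣ α x := by
    intro x
    have : α x ∈ α.range := ⟨x, rfl⟩
    rw [hm, AddSubgroup.mem_closure_singleton] at this
    obtain ⟨n, hn⟩ := this
    exact ⟨n, by rw [← hn, smul_eq_mul, mul_comm]⟩
  obtain ⟨g, hg⟩ : m ∈ α.range := by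
    rw [hm]; exact AddSubgroup.subset_closure rfl
  refine ⟨AddMonoidHom.mk' (fun x => α x / m) fun x y => ?_, zmultiplesHom G g, fun c => ?_,
    fun x => ?_⟩
  · rw [map_add, Int.add_ediv_of_dvd_left (hdvd x)]
  · simp [hg, hm0]
  · simp only [AddMonoidHom.mk'_apply]
    constructor
    · intro h
      have := Int.ediv_mul_cancel (hdvd x)
      rw [← this, h, zero_mul]
    · intro h; simp [h]

/-- If `e` sent `G` into `H`, the first coordinate of `e (k, u)` would be `k * c` for a constant
`c`, nonzero by surjectivity. Then an element with nonzero first coordinate could not be sent into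
`H`. -/
theorem fst_ne_zero_of_fst_ne_zero {e : ℤ × G ≃+ ℤ × H} (h : ∃ x, (e.symm (0, x)).1 ≠ 0) :
    ∃ y, (e (0, y)).1 ≠ 0 := by
  by_contra! hcon
  obtain ⟨x, hx⟩ := h
  set n := (e.symm (0, x)).1 with hn
  have hsplit : ∀ (k : ℤ) (u : G), (e (k, u)).1 = k * (e (1, 0)).1 := by
    intro k u
    have : ((k : ℤ), u) = k • ((1 : ℤ), (0 : G)) + (0, u) := by simp
    rw [this, map_add, map_zsmul, Prod.fst_add, hcon, add_zero, Prod.smul_fst, smul_eq_mul]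
  have h1 : (e (n, (e.symm (0, x)).2)).1 = 0 := by
    have : (n, (e.symm (0, x)).2) = e.symm (0, x) := rfl
    rw [this, e.apply_symm_apply]
  have h2 : (e (e.symm (1, 0))).1 = 1 := by rw [e.apply_symm_apply]
  have h3 := hsplit (e.symm (1, 0)).1 (e.symm (1, 0)).2
  rw [Prod.mk.eta, h2] at h3
  rw [hsplit] at h1
  rcases mul_eq_zero.1 h1 with h | h
  · exact hx h
  · rw [h, mul_zero] at h3
    exact one_ne_zero h3

/-- The `ℤ`-components of `e` on `G` and of its inverse on `H` vanish together. If they vanish, `e`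
restricts to a bijection of `G` with `H`; otherwise both split off a copy of `ℤ`. -/
theorem int : Cancellable ℤ := by
  intro G H _ _ e
  let α : G →+ ℤ := ((AddMonoidHom.fst ℤ H).comp e.toAddMonoidHom).comp (AddMonoidHom.inr ℤ G)
  let γ : H →+ ℤ := ((AddMonoidHom.fst ℤ G).comp e.symm.toAddMonoidHom).comp (AddMonoidHom.inr ℤ H)
  have hα : ∀ x, α x = (e (0, x)).1 := fun _ => rfl
  have hγ : ∀ x, γ x = (e.symm (0, x)).1 := fun _ => rfl
  by_cases h : α = 0
  · have h' : γ = 0 := by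
      by_contra hne
      obtain ⟨x, hx⟩ := DFunLike.ne_iff.1 hne
      obtain ⟨y, hy⟩ := fst_ne_zero_of_fst_ne_zero (e := e) ⟨x, hx⟩
      exact hy (DFunLike.congr_fun h y)
    have ha : ∀ x, e (0, x) = (0, (e (0, x)).2) := fun x =>
      Prod.ext (DFunLike.congr_fun h x) rfl
    have hb : ∀ x, e.symm (0, x) = (0, (e.symm (0, x)).2) := fun x =>
      Prod.ext (DFunLike.congr_fun h' x) rfl
    refine exists_equiv_of_bijective e (Function.bijective_iff_has_inverse.2
      ⟨fun y => (e.symm (0, y)).2, fun x => ?_, fun y => ?_⟩)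
    · simp only [← ha, e.symm_apply_apply]
    · simp only [← hb, e.apply_symm_apply]
  · have h' : γ ≠ 0 := by
      obtain ⟨x, hx⟩ := DFunLike.ne_iff.1 h
      obtain ⟨y, hy⟩ := fst_ne_zero_of_fst_ne_zero (e := e.symm) ⟨x, hx⟩
      exact DFunLike.ne_iff.2 ⟨y, hy⟩
    obtain ⟨q, s, h1, h2⟩ := exists_retraction_int h
    obtain ⟨q', s', h3, h4⟩ := exists_retraction_int h'
    exact exists_equiv_of_retractions e q s h1 h2 q' s' h3 h4

/-- The ring `ZMod (p ^ k)` is local or trivial, so `u = ε 1 * ε' 1` or `1 - u` is a unit. If `u` is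
a unit, the component `G → H` of `e` is bijective. If `1 - u` is a unit, then `α ∘ ζ'` and `γ ∘ ζ`,
both multiplication by `1 - u`, are invertible, so `α` and `γ` split. -/
theorem zmod_prime_pow {p : ℕ} (hp : p.Prime) (k : ℕ) : Cancellable (ZMod (p ^ k)) := by
  obtain ⟨n, hn⟩ : ∃ n, n = p ^ k := ⟨_, rfl⟩
  rw [← hn]
  intro G H _ _ e
  have : NeZero n := ⟨hn ▸ pow_ne_zero _ hp.ne_zero⟩
  let α : G →+ ZMod n :=
    ((AddMonoidHom.fst _ H).comp e.toAddMonoidHom).comp (AddMonoidHom.inr _ G)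
  let γ : H →+ ZMod n :=
    ((AddMonoidHom.fst _ G).comp e.symm.toAddMonoidHom).comp (AddMonoidHom.inr _ H)
  let ζ : ZMod n →+ H :=
    ((AddMonoidHom.snd _ H).comp e.toAddMonoidHom).comp (AddMonoidHom.inl _ G)
  let ζ' : ZMod n →+ G :=
    ((AddMonoidHom.snd _ G).comp e.symm.toAddMonoidHom).comp (AddMonoidHom.inl _ H)
  let ε : ZMod n →+ ZMod n :=
    ((AddMonoidHom.fst _ H).comp e.toAddMonoidHom).comp (AddMonoidHom.inl _ G)
  let ε' : ZMod n →+ ZMod n :=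
    ((AddMonoidHom.fst _ G).comp e.symm.toAddMonoidHom).comp (AddMonoidHom.inl _ H)
  have hmul : ∀ (φ : ZMod n →+ ZMod n) (a : ZMod n), φ a = φ 1 * a := by
    intro φ a
    have : a = a.val • (1 : ZMod n) := by simp
    conv_lhs => rw [this, map_nsmul]
    rw [nsmul_eq_mul, mul_comm]
    simp
  have hpair : ∀ (a : ZMod n) (x : G), (a, x) = (a, 0) + (0, x) := by simp
  have hpair' : ∀ (a : ZMod n) (x : H), (a, x) = (a, 0) + (0, x) := by simp
  have s1 : ∀ a, ε' (ε a) + γ (ζ a) = a := by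
    intro a
    have : (e.symm ((e (a, 0)).1, (e (a, 0)).2)).1 = a := by simp
    rw [hpair', map_add] at this
    exact this
  have s2 : ∀ a, ε (ε' a) + α (ζ' a) = a := by
    intro a
    have : (e ((e.symm (a, 0)).1, (e.symm (a, 0)).2)).1 = a := by simp
    rw [hpair, map_add] at this
    exact this
  have s3 : ∀ a, γ (ζ a) = (1 - ε 1 * ε' 1) * a := by
    intro a
    have := s1 a
    rw [hmul ε', hmul ε] at this
    linear_combination this
  have s4 : ∀ a, α (ζ' a) = (1 - ε 1 * ε' 1) * a := by
    intro a
    have := s2 a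
    rw [hmul ε, hmul ε'] at this
    linear_combination this
  have hunit : IsUnit (ε 1 * ε' 1) ∨ IsUnit (1 - ε 1 * ε' 1) := by
    have key : ∀ u : ZMod n, ¬ IsUnit u → p ∣ u.val := by
      intro u hu
      rw [← ZMod.natCast_zmod_val u, ZMod.isUnit_iff_coprime] at hu
      by_contra hd
      have hcop := Nat.Coprime.pow_right k ((Nat.Prime.coprime_iff_not_dvd hp).2 hd).symm
      rw [← hn] at hcop
      exact hu hcop
    by_contra! hcon
    have h1 := key _ hcon.1
    have h2 := key _ hcon.2
    -- For `k = 0` the ring is trivial and everything is a unit; otherwise it maps to `ZMod p`,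
    -- where `1` would be a sum of two zeros.
    by_cases hk : k = 0
    · have : Subsingleton (ZMod n) := by
        rw [hn, hk, pow_zero]; infer_instance
      exact hcon.1 (isUnit_of_subsingleton _)
    · have hpn : p ∣ n := hn ▸ dvd_pow_self p hk
      have := congrArg (ZMod.castHom hpn (ZMod p))
        (add_sub_cancel (ε 1 * ε' 1) (1 : ZMod n))
      have hz : ∀ u : ZMod n, p ∣ u.val → ZMod.castHom hpn (ZMod p) u = 0 := by
        intro u hu
        rw [ZMod.castHom_apply, ZMod.cast_eq_val]
        exact (ZMod.natCast_eq_zero_iff _ _).2 hu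
      rw [map_add, hz _ h1, hz _ h2, map_one, add_zero] at this
      have : Fact p.Prime := ⟨hp⟩
      exact zero_ne_one ‹(0 : ZMod p) = 1›
  rcases hunit with hu | hu
  · have hε' : IsUnit (ε' 1) := isUnit_of_mul_isUnit_right hu
    obtain ⟨u, hu'⟩ := hε'
    refine exists_equiv_of_bijective e ⟨?_, ?_⟩
    · have : ∀ x : G, (e (0, x)).2 = 0 → x = 0 := by
        intro x hx
        have h1 : e.symm (α x, 0) = (0, x) := by
          rw [AddEquiv.symm_apply_eq]
          exact Prod.ext rfl hx.symm
        have h2 : ε' (α x) = 0 := congrArg Prod.fst h1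
        rw [hmul, ← hu', Units.mul_right_eq_zero] at h2
        rw [h2] at h1
        have h3 : e.symm (0, 0) = 0 := map_zero e.symm
        rw [h3] at h1
        exact (congrArg Prod.snd h1).symm
      intro x y hxy
      have hsub : (e (0, x - y)).2 = 0 := by
        have : ((0 : ZMod n), x - y) = (0, x) - (0, y) := by simp
        rw [this, map_sub, Prod.snd_sub]
        exact sub_eq_zero.2 hxy
      exact sub_eq_zero.1 (this _ hsub)
    · intro y
      -- The value of `a` solves `ε' a + γ y = 0`, so that the inverse of `e` sends `(a, y)` into
      -- `G`.
      set a : ZMod n := - (↑u⁻¹ * γ y) with ha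
      have h1 : (e.symm (a, y)).1 = 0 := by
        rw [hpair', map_add]
        change ε' a + γ y = 0
        rw [hmul, ← hu', ha]
        simp
      refine ⟨(e.symm (a, y)).2, ?_⟩
      have : ((0 : ZMod n), (e.symm (a, y)).2) = e.symm (a, y) := Prod.ext h1.symm rfl
      simp [this]
  · obtain ⟨u, hu'⟩ := hu
    have hker : ∀ a : ZMod n, ↑u⁻¹ * a = 0 ↔ a = 0 := fun a => Units.mul_right_eq_zero _
    refine exists_equiv_of_retractions e
      ((AddMonoidHom.mulLeft (↑u⁻¹ : ZMod n)).comp α) ζ' (fun c => ?_) (fun x => ?_)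
      ((AddMonoidHom.mulLeft (↑u⁻¹ : ZMod n)).comp γ) ζ (fun c => ?_) (fun x => ?_)
    · simp [s4, ← hu']
    · exact hker _
    · simp [s3, ← hu']
    · exact hker _

theorem of_fg [AddGroup.FG A] : Cancellable A := by
  classical
  obtain ⟨n, ι, _, p, hp, k, ⟨i⟩⟩ := AddCommGroup.equiv_free_prod_directSum_zmod A
  refine of_equiv i.symm (prod ?_ ?_)
  · exact of_equiv (Finsupp.linearEquivFunOnFinite ℤ ℤ (Fin n)).symm.toAddEquiv
      (pi _ fun _ => int)
  · exact of_equiv (DirectSum.addEquivProd _).symm (pi _ fun j => zmod_prime_pow (hp j) (k j))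

end Cancellable

variable {E : Type} [AddCommGroup E]

/-- The isomorphism `A × G ≃ E` of an internal direct sum. -/
noncomputable def addEquivOfIsCompl {A G : AddSubgroup E} (h : IsCompl A G) : A × G ≃+ E :=
  AddEquiv.ofBijective (A.subtype.coprod G.subtype) <| by
    constructor
    · rw [injective_iff_map_eq_zero]
      rintro ⟨a, g⟩ h0
      simp only [AddMonoidHom.coprod_apply, AddSubgroup.subtype_apply] at h0
      have ha : (a : E) = ((-g : G) : E) := by
        rw [eq_comm]; simpa using neg_eq_of_add_eq_zero_left h0
      have ha0 : (a : E) = 0 := AddSubgroup.disjoint_def.1 h.disjoint a.2 (ha ▸ (-g).2)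
      have hg0 : (g : E) = 0 := by rw [ha0, zero_add] at h0; exact h0
      exact Prod.ext (Subtype.ext ha0) (Subtype.ext hg0)
    · intro x
      have : x ∈ A ⊔ G := by rw [h.sup_eq_top]; trivial
      obtain ⟨a, ha, g, hg, rfl⟩ := AddSubgroup.mem_sup.1 this
      exact ⟨(⟨a, ha⟩, ⟨g, hg⟩), rfl⟩

@[simp]
theorem addEquivOfIsCompl_apply {A G : AddSubgroup E} (h : IsCompl A G) (a : A) (g : G) :
    addEquivOfIsCompl h (a, g) = a + g := rfl

/-- That `f` is the identity on `G ∩ H` is what later allows `f` to be described by finitely many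
values. -/
theorem exists_equiv_of_isCompl_of_fg {A B G H : AddSubgroup E} (hAG : IsCompl A G)
    (hBH : IsCompl B H) (i : A ≃+ B) (hA : AddGroup.FG A) :
    ∃ f : G ≃+ H, ∀ (x : G) (y : H), (x : E) = y → f x = y := by
  obtain ⟨f, hf⟩ := Cancellable.of_fg (A := A) G H
    (((addEquivOfIsCompl hAG).trans (addEquivOfIsCompl hBH).symm).trans
      (i.symm.prodCongr (AddEquiv.refl H)))
  refine ⟨f, fun x y h => hf x y ?_⟩
  have : (addEquivOfIsCompl hBH).symm (x : E) = (0, y) := by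
    rw [AddEquiv.symm_apply_eq]
    simp [h]
  simp [AddEquiv.prodCongr, this]

end Cancellation

/-! ### Lower bound: the halting set coded into free abelian groups of rank two. -/

noncomputable section LowerBound

theorem isSetIndex_of_primrecPred {p : ℕ × ℕ → Prop} (hp : PrimrecPred p) :
    ∃ s : ℕ → ℕ, Computable s ∧ ∀ i, IsSetIndex (s i) {n | p (i, n)} := by
  classical
  have h : Primrec fun x : ℕ × ℕ => if p x then 1 else 0 :=
    Primrec.ite hp (Primrec.const 1) (Primrec.const 0)
  obtain ⟨s, hs, H⟩ := exists_computable_index (α := ℕ)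
    (f := fun i n => Part.some (if p (i, n) then 1 else 0)) h.to_comp.partrec
  refine ⟨s, hs, fun i n => ?_⟩
  rw [H]
  simp [charFun]

/-- The computation of `φ_i(i)` takes exactly `s` steps. -/
def HaltsAt (i s : ℕ) : Prop :=
  (Nat.Partrec.Code.evaln s (Denumerable.ofNat Nat.Partrec.Code i) i).isSome = true ∧
    (Nat.Partrec.Code.evaln (s - 1) (Denumerable.ofNat Nat.Partrec.Code i) i).isSome = false

theorem HaltsAt.unique {i s t : ℕ} (hs : HaltsAt i s) (ht : HaltsAt i t) : s = t := by
  have key : ∀ {s t : ℕ}, HaltsAt i s → HaltsAt i t → ¬ s < t := by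
    intro s t hs ht hlt
    obtain ⟨v, hv⟩ := Option.isSome_iff_exists.1 hs.1
    have := Nat.Partrec.Code.evaln_mono (Nat.le_sub_one_of_lt hlt) hv
    have h2 := ht.2
    rw [Option.mem_def.1 this] at h2
    simp at h2
  exact le_antisymm (not_lt.1 (key ht hs)) (not_lt.1 (key hs ht))

theorem mem_haltingSet_iff_exists_haltsAt {i : ℕ} : i ∈ haltingSet ↔ ∃ s, HaltsAt i s := by
  classical
  constructor
  · intro h
    obtain ⟨v, hv⟩ := Part.dom_iff_mem.1 h
    obtain ⟨k, hk⟩ := Nat.Partrec.Code.evaln_complete.1 hv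
    have hex : ∃ k, (Nat.Partrec.Code.evaln k
        (Denumerable.ofNat Nat.Partrec.Code i) i).isSome = true := ⟨k, by rw [Option.mem_def.1 hk]; rfl⟩
    refine ⟨Nat.find hex, Nat.find_spec hex, ?_⟩
    -- At `0` truncated subtraction gives `0 - 1 = 0`, but no computation succeeds with bound `0`.
    by_cases h0 : Nat.find hex = 0
    · rw [h0]
      simp [Nat.Partrec.Code.evaln]
    · simpa using Nat.find_min hex (Nat.sub_lt (Nat.pos_of_ne_zero h0) one_pos)
  · rintro ⟨s, hs, -⟩
    obtain ⟨v, hv⟩ := Option.isSome_iff_exists.1 hs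
    exact Part.dom_iff_mem.2 ⟨v, Nat.Partrec.Code.evaln_sound hv⟩

theorem primrecPred_haltsAt : PrimrecPred fun x : ℕ × ℕ => HaltsAt x.1 x.2 := by
  have h : Primrec fun x : ℕ × ℕ =>
      (Nat.Partrec.Code.evaln x.2 (Denumerable.ofNat Nat.Partrec.Code x.1) x.1).isSome :=
    Primrec.option_isSome.comp (Nat.Partrec.Code.primrec_evaln.comp
      (((Primrec.snd).pair ((Primrec.ofNat _).comp Primrec.fst)).pair Primrec.fst))
  have h' := h.comp (Primrec.fst.pair (Primrec.nat_sub.comp Primrec.snd (Primrec.const 1)))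
  exact (Primrec.eq.comp h (Primrec.const true)).and (Primrec.eq.comp h' (Primrec.const false))

/-- The numbers that name the elements of `ℤ × d_i ℤ`, where `d_i` is `1` if `i ∈ ∅'` and `2`
otherwise. An integer is written as a difference of natural numbers, and a name with odd second
coordinate also records the halting time. -/
def IsName (i : ℕ) (x : ℕ × ℕ × ℕ × ℕ × ℕ) : Prop :=
  x.1 * x.2.1 = 0 ∧ x.2.2.1 * x.2.2.2.1 = 0 ∧
    ((x.2.2.2.2 = 0 ∧ (x.2.2.1 + x.2.2.2.1) % 2 = 0) ∨
      ((x.2.2.1 + x.2.2.2.1) % 2 = 1 ∧ HaltsAt i x.2.2.2.2))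

/-- The tuple coded by a natural number. -/
def nameOf (n : ℕ) : ℕ × ℕ × ℕ × ℕ × ℕ := Denumerable.ofNat _ n

theorem primrec_nameOf : Primrec nameOf := Primrec.ofNat _

theorem nameOf_encode (x : ℕ × ℕ × ℕ × ℕ × ℕ) : nameOf (Encodable.encode x) = x :=
  Denumerable.ofNat_encode _

theorem nameOf_injective : Function.Injective nameOf :=
  (Denumerable.eqv (ℕ × ℕ × ℕ × ℕ × ℕ)).symm.injective

attribute [irreducible] nameOf HaltsAt

/-- The first coordinate of the pair of integers that is named. -/
def nameFst (n : ℕ) : ℤ := (nameOf n).1 - (nameOf n).2.1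

/-- The second coordinate of the pair of integers that is named. -/
def nameSnd (n : ℕ) : ℤ := (nameOf n).2.2.1 - (nameOf n).2.2.2.1

/-- The universe of the group attached to `i`. -/
def nameSet (i : ℕ) : Set ℕ := {n | IsName i (nameOf n)}

open Classical in
/-- The generator of the second factor of the group attached to `i`. -/
def nameGen (i : ℕ) : ℤ := if i ∈ haltingSet then 1 else 2

theorem mem_nameSet {i n : ℕ} : n ∈ nameSet i ↔ IsName i (nameOf n) := Iff.rfl

theorem nameGen_ne_zero (i : ℕ) : nameGen i ≠ 0 := by
  unfold nameGen; split_ifs <;> norm_num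

theorem nameGen_dvd {i n : ℕ} (h : n ∈ nameSet i) : nameGen i ∣ nameSnd n := by
  rw [mem_nameSet] at h
  unfold nameGen
  split_ifs with hi
  · exact one_dvd _
  · rcases h.2.2 with h | h
    · have := h.2
      unfold nameSnd
      omega
    · exact absurd (mem_haltingSet_iff_exists_haltsAt.2 ⟨_, h.2⟩) hi

/-- Names are canonical: the vanishing products make each difference reduced, and the last entry is
`0` or the unique halting time, according to the parity of the second coordinate. -/
theorem name_ext {i m n : ℕ} (hm : m ∈ nameSet i) (hn : n ∈ nameSet i)
    (h1 : nameFst m = nameFst n) (h2 : nameSnd m = nameSnd n) : m = n := by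
  rw [mem_nameSet] at hm hn
  apply nameOf_injective
  have key : ∀ {a b c d : ℕ}, a * b = 0 → c * d = 0 → (a : ℤ) - b = c - d → a = c ∧ b = d := by
    intro a b c d h h' h''
    rcases Nat.mul_eq_zero.1 h with rfl | rfl <;> rcases Nat.mul_eq_zero.1 h' with rfl | rfl <;> omega
  obtain ⟨a1, a2⟩ := key hm.1 hn.1 h1
  obtain ⟨a3, a4⟩ := key hm.2.1 hn.2.1 h2
  have a5 : (nameOf m).2.2.2.2 = (nameOf n).2.2.2.2 := by
    rcases hm.2.2 with hm | hm <;> rcases hn.2.2 with hn | hn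
    · rw [hm.1, hn.1]
    · omega
    · omega
    · exact hm.2.unique hn.2
  exact Prod.ext a1 (Prod.ext a2 (Prod.ext a3 (Prod.ext a4 a5)))

theorem exists_name (i : ℕ) (u v : ℤ) :
    ∃ n ∈ nameSet i, nameFst n = u ∧ nameSnd n = nameGen i * v := by
  obtain ⟨w, hw⟩ : ∃ w, w = nameGen i * v := ⟨_, rfl⟩
  rw [← hw]
  have hσ : ∃ σ, (σ = 0 ∧ (w.toNat + (-w).toNat) % 2 = 0) ∨
      ((w.toNat + (-w).toNat) % 2 = 1 ∧ HaltsAt i σ) := by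
    by_cases hpar : (w.toNat + (-w).toNat) % 2 = 0
    · exact ⟨0, Or.inl ⟨rfl, hpar⟩⟩
    · have hi : i ∈ haltingSet := by
        by_contra hi
        rw [nameGen, if_neg hi] at hw
        omega
      obtain ⟨s, hs⟩ := mem_haltingSet_iff_exists_haltsAt.1 hi
      exact ⟨s, Or.inr ⟨by omega, hs⟩⟩
  obtain ⟨σ, hσ⟩ := hσ
  have hn : nameOf (Encodable.encode (u.toNat, (-u).toNat, w.toNat, (-w).toNat, σ)) =
      (u.toNat, (-u).toNat, w.toNat, (-w).toNat, σ) := nameOf_encode _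
  refine ⟨Encodable.encode (u.toNat, (-u).toNat, w.toNat, (-w).toNat, σ), ?_, ?_, ?_⟩
  · rw [mem_nameSet, hn]
    have hz : ∀ z : ℤ, z.toNat * (-z).toNat = 0 := fun z => by
      rcases le_total 0 z with h | h
      · rw [Int.toNat_of_nonpos (by omega : -z ≤ 0), mul_zero]
      · rw [Int.toNat_of_nonpos h, zero_mul]
    exact ⟨hz _, hz _, hσ⟩
  · rw [nameFst, hn]
    simp only
    omega
  · rw [nameSnd, hn]
    simp only
    omega

/-- Names correspond to pairs of integers. -/
def nameEquiv (i : ℕ) : nameSet i ≃ ℤ × ℤ :=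
  Equiv.ofBijective (fun n => (nameFst n, nameSnd n / nameGen i)) <| by
    constructor
    · rintro ⟨m, hm⟩ ⟨n, hn⟩ h
      obtain ⟨h1, h2⟩ := Prod.ext_iff.1 h
      refine Subtype.ext (name_ext hm hn h1 ?_)
      rw [← Int.mul_ediv_cancel' (nameGen_dvd hm), ← Int.mul_ediv_cancel' (nameGen_dvd hn)]
      exact congrArg _ h2
    · rintro ⟨u, v⟩
      obtain ⟨n, hn, h1, h2⟩ := exists_name i u v
      exact ⟨⟨n, hn⟩, Prod.ext h1 (by simp [h2, nameGen_ne_zero])⟩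

instance (i : ℕ) : AddCommGroup (nameSet i) := (nameEquiv i).addCommGroup

/-- The group attached to `i` is free abelian of rank two. -/
def nameAddEquiv (i : ℕ) : nameSet i ≃+ ℤ × ℤ := (nameEquiv i).addEquiv

theorem nameAddEquiv_apply {i : ℕ} (x : nameSet i) :
    nameAddEquiv i x = (nameFst x, nameSnd x / nameGen i) := rfl

theorem name_add_eq_iff {i : ℕ} (x y z : nameSet i) : x + y = z ↔
    nameFst x + nameFst y = nameFst z ∧ nameSnd x + nameSnd y = nameSnd z := by
  rw [← (nameAddEquiv i).injective.eq_iff, map_add]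
  simp only [nameAddEquiv_apply, Prod.mk_add_mk, Prod.mk.injEq]
  refine and_congr_right fun _ => ?_
  rw [← mul_right_inj' (nameGen_ne_zero i), mul_add, Int.mul_ediv_cancel' (nameGen_dvd x.2),
    Int.mul_ediv_cancel' (nameGen_dvd y.2), Int.mul_ediv_cancel' (nameGen_dvd z.2)]

theorem primrecPred_mem_nameSet : PrimrecPred fun x : ℕ × ℕ => x.2 ∈ nameSet x.1 := by
  have n0 : Primrec fun x : ℕ × ℕ => nameOf x.2 := primrec_nameOf.comp Primrec.snd
  have n1 := Primrec.fst.comp n0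
  have m2 := Primrec.snd.comp n0
  have n2 := Primrec.fst.comp m2
  have m3 := Primrec.snd.comp m2
  have n3 := Primrec.fst.comp m3
  have m4 := Primrec.snd.comp m3
  have n4 := Primrec.fst.comp m4
  have n5 := Primrec.snd.comp m4
  have par := Primrec.nat_mod.comp (Primrec.nat_add.comp n3 n4) (Primrec.const 2)
  have hz := Primrec.eq.comp n5 (Primrec.const 0)
  have h0 := Primrec.eq.comp par (Primrec.const 0)
  have h1 := Primrec.eq.comp par (Primrec.const 1)
  have hh := primrecPred_haltsAt.comp (Primrec.fst.pair n5)
  exact (Primrec.eq.comp (Primrec.nat_mul.comp n1 n2) (Primrec.const 0)).and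
    ((Primrec.eq.comp (Primrec.nat_mul.comp n3 n4) (Primrec.const 0)).and
      ((hz.and h0).or (h1.and hh)))

attribute [irreducible] nameSet

theorem nameFst_add_eq_iff (x y z : ℕ) : nameFst x + nameFst y = nameFst z ↔
    (nameOf x).1 + (nameOf y).1 + (nameOf z).2.1 =
      (nameOf x).2.1 + (nameOf y).2.1 + (nameOf z).1 := by
  unfold nameFst; omega

theorem nameSnd_add_eq_iff (x y z : ℕ) : nameSnd x + nameSnd y = nameSnd z ↔
    (nameOf x).2.2.1 + (nameOf y).2.2.1 + (nameOf z).2.2.2.1 =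
      (nameOf x).2.2.2.1 + (nameOf y).2.2.2.1 + (nameOf z).2.2.1 := by
  unfold nameSnd; omega

theorem primrecPred_name_add_eq : PrimrecPred fun w : ℕ × ℕ × ℕ =>
    nameFst w.1 + nameFst w.2.1 = nameFst w.2.2 ∧ nameSnd w.1 + nameSnd w.2.1 = nameSnd w.2.2 := by
  have x := primrec_nameOf.comp (Primrec.fst (α := ℕ) (β := ℕ × ℕ))
  have y := primrec_nameOf.comp
    (Primrec.fst.comp (Primrec.snd (α := ℕ) (β := ℕ × ℕ)))
  have z := primrec_nameOf.comp
    (Primrec.snd.comp (Primrec.snd (α := ℕ) (β := ℕ × ℕ)))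
  have c1 : Primrec fun t : ℕ × ℕ × ℕ × ℕ × ℕ => t.1 := Primrec.fst
  have c2 : Primrec fun t : ℕ × ℕ × ℕ × ℕ × ℕ => t.2.1 := Primrec.fst.comp Primrec.snd
  have c3 : Primrec fun t : ℕ × ℕ × ℕ × ℕ × ℕ => t.2.2.1 :=
    Primrec.fst.comp (Primrec.snd.comp Primrec.snd)
  have c4 : Primrec fun t : ℕ × ℕ × ℕ × ℕ × ℕ => t.2.2.2.1 :=
    Primrec.fst.comp (Primrec.snd.comp (Primrec.snd.comp Primrec.snd))
  have e1 := Primrec.eq.comp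
    (Primrec.nat_add.comp (Primrec.nat_add.comp (c1.comp x) (c1.comp y)) (c2.comp z))
    (Primrec.nat_add.comp (Primrec.nat_add.comp (c2.comp x) (c2.comp y)) (c1.comp z))
  have e2 := Primrec.eq.comp
    (Primrec.nat_add.comp (Primrec.nat_add.comp (c3.comp x) (c3.comp y)) (c4.comp z))
    (Primrec.nat_add.comp (Primrec.nat_add.comp (c4.comp x) (c4.comp y)) (c3.comp z))
  exact (e1.and e2).of_eq fun w => by rw [nameFst_add_eq_iff, nameSnd_add_eq_iff]

theorem mem_atomicDiagram_nameSet {i n : ℕ} : n ∈ atomicDiagram (nameSet i) ↔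
    (n % 2 = 0 ∧ (n / 2).unpair.1 = (n / 2).unpair.2 ∧ (n / 2).unpair.1 ∈ nameSet i) ∨
    (n % 2 = 1 ∧ (n / 2).unpair.1.unpair.1 ∈ nameSet i ∧ (n / 2).unpair.1.unpair.2 ∈ nameSet i ∧
      (n / 2).unpair.2 ∈ nameSet i ∧
      (nameFst (n / 2).unpair.1.unpair.1 + nameFst (n / 2).unpair.1.unpair.2 =
        nameFst (n / 2).unpair.2 ∧
      nameSnd (n / 2).unpair.1.unpair.1 + nameSnd (n / 2).unpair.1.unpair.2 =
        nameSnd (n / 2).unpair.2)) := by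
  constructor
  · rintro (⟨x, rfl⟩ | ⟨x, y, rfl⟩)
    · left
      simp
    · right
      have h1 : ∀ a, (2 * a + 1) / 2 = a := fun a => by omega
      have h2 : ∀ a, (2 * a + 1) % 2 = 1 := fun a => by omega
      simp only [h1, h2, Nat.unpair_pair, Subtype.coe_prop, true_and]
      exact (name_add_eq_iff x y (x + y)).1 rfl
  · rintro (⟨h1, h2, h3⟩ | ⟨h1, hx, hy, hz, h⟩)
    · left
      refine ⟨⟨_, h3⟩, ?_⟩
      simp only
      conv_rhs => rw [show Nat.pair (n / 2).unpair.1 (n / 2).unpair.1 = n / 2 by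
        conv_rhs => rw [← Nat.pair_unpair (n / 2), ← h2]]
      omega
    · right
      refine ⟨⟨_, hx⟩, ⟨_, hy⟩, ?_⟩
      rw [(name_add_eq_iff ⟨_, hx⟩ ⟨_, hy⟩ ⟨_, hz⟩).2 h]
      simp only [Nat.pair_unpair]
      omega

theorem primrecPred_atomicDiagram_nameSet :
    PrimrecPred fun x : ℕ × ℕ => x.2 ∈ atomicDiagram (nameSet x.1) := by
  have par : Primrec fun x : ℕ × ℕ => x.2 % 2 := Primrec.nat_mod.comp Primrec.snd (Primrec.const 2)
  have half : Primrec fun x : ℕ × ℕ => (x.2 / 2).unpair :=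
    Primrec.unpair.comp (Primrec.nat_div.comp Primrec.snd (Primrec.const 2))
  have u1 := Primrec.fst.comp half
  have u2 := Primrec.snd.comp half
  have u11 := Primrec.fst.comp (Primrec.unpair.comp u1)
  have u12 := Primrec.snd.comp (Primrec.unpair.comp u1)
  have name {f : ℕ × ℕ → ℕ} (hf : Primrec f) : PrimrecPred fun x => f x ∈ nameSet x.1 :=
    primrecPred_mem_nameSet.comp (Primrec.fst.pair hf)
  exact (((Primrec.eq.comp par (Primrec.const 0)).and ((Primrec.eq.comp u1 u2).and (name u1))).or
    ((Primrec.eq.comp par (Primrec.const 1)).and ((name u11).and ((name u12).and ((name u2).and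
      (primrecPred_name_add_eq.comp (u11.pair (u12.pair u2)))))))).of_eq
    fun x => mem_atomicDiagram_nameSet.symm

/-- The elements with second coordinate zero. -/
def firstFactor (i : ℕ) : AddSubgroup (nameSet i) :=
  ((AddMonoidHom.snd ℤ ℤ).comp (nameAddEquiv i).toAddMonoidHom).ker

/-- The elements with first coordinate zero. -/
def secondFactor (i : ℕ) : AddSubgroup (nameSet i) :=
  ((AddMonoidHom.fst ℤ ℤ).comp (nameAddEquiv i).toAddMonoidHom).ker

theorem mem_firstFactor {i : ℕ} {x : nameSet i} : x ∈ firstFactor i ↔ (nameAddEquiv i x).2 = 0 :=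
  Iff.rfl

theorem mem_secondFactor {i : ℕ} {x : nameSet i} : x ∈ secondFactor i ↔ (nameAddEquiv i x).1 = 0 :=
  Iff.rfl

/-- The first factor is infinite cyclic. -/
def firstFactorEquiv (i : ℕ) : firstFactor i ≃+ ℤ where
  toFun x := (nameAddEquiv i x).1
  invFun u := ⟨(nameAddEquiv i).symm (u, 0), by simp [mem_firstFactor]⟩
  left_inv x := by
    refine Subtype.ext ((AddEquiv.symm_apply_eq _).2 (Prod.ext rfl ?_))
    exact (mem_firstFactor.1 x.2).symm
  right_inv u := by simp
  map_add' x y := by simp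

/-- The second factor is infinite cyclic. -/
def secondFactorEquiv (i : ℕ) : secondFactor i ≃+ ℤ where
  toFun x := (nameAddEquiv i x).2
  invFun u := ⟨(nameAddEquiv i).symm (0, u), by simp [mem_secondFactor]⟩
  left_inv x := by
    refine Subtype.ext ((AddEquiv.symm_apply_eq _).2 (Prod.ext ?_ rfl))
    exact (mem_secondFactor.1 x.2).symm
  right_inv u := by simp
  map_add' x y := by simp

theorem isCompl_factors (i : ℕ) : IsCompl (secondFactor i) (firstFactor i) := by
  constructor
  · rw [AddSubgroup.disjoint_def]
    intro x h1 h2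
    exact (nameAddEquiv i).map_eq_zero_iff.1 (Prod.ext h1 h2)
  · rw [codisjoint_iff, eq_top_iff]
    intro x _
    refine AddSubgroup.mem_sup.2 ⟨(nameAddEquiv i).symm (0, (nameAddEquiv i x).2), ?_,
      (nameAddEquiv i).symm ((nameAddEquiv i x).1, 0), ?_, ?_⟩
    · simp [mem_secondFactor]
    · simp [mem_firstFactor]
    · rw [← map_add, AddEquiv.symm_apply_eq]
      simp

theorem underlying_firstFactor (i : ℕ) :
    underlying (firstFactor i) = {n | n ∈ nameSet i ∧ (nameOf n).2.2.1 = (nameOf n).2.2.2.1} := by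
  have key : ∀ x : nameSet i, x ∈ firstFactor i ↔ (nameOf x).2.2.1 = (nameOf x).2.2.2.1 := by
    intro x
    have h : nameSnd x / nameGen i = 0 ↔ nameSnd x = 0 := by
      conv_rhs => rw [← Int.mul_ediv_cancel' (nameGen_dvd x.2)]
      simp [nameGen_ne_zero]
    rw [mem_firstFactor, nameAddEquiv_apply, h]
    unfold nameSnd
    omega
  ext n
  constructor
  · rintro ⟨x, hx, rfl⟩
    exact ⟨x.2, (key x).1 hx⟩
  · rintro ⟨hn, h⟩
    exact ⟨⟨n, hn⟩, (key _).2 h, rfl⟩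

theorem underlying_secondFactor (i : ℕ) :
    underlying (secondFactor i) = {n | n ∈ nameSet i ∧ (nameOf n).1 = (nameOf n).2.1} := by
  have key : ∀ x : nameSet i, x ∈ secondFactor i ↔ (nameOf x).1 = (nameOf x).2.1 := by
    intro x
    rw [mem_secondFactor, nameAddEquiv_apply]
    unfold nameFst
    omega
  ext n
  constructor
  · rintro ⟨x, hx, rfl⟩
    exact ⟨x.2, (key x).1 hx⟩
  · rintro ⟨hn, h⟩
    exact ⟨⟨n, hn⟩, (key _).2 h, rfl⟩

/-- The two decompositions are one decomposition with its factors interchanged. All index sets are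
decidable uniformly in `i`, because a name only has to be checked against the halting time that it
carries. -/
theorem exists_computable_input : ∃ s : ℕ → ℕ × ℕ × ℕ, Computable s ∧ ∀ i,
    IsInput (s i).1 (s i).2.1 (s i).2.2 (s i).2.2 (s i).2.1 1 (nameSet i) (secondFactor i)
      (firstFactor i) (firstFactor i) (secondFactor i) := by
  have nm : Primrec fun x : ℕ × ℕ => nameOf x.2 := primrec_nameOf.comp Primrec.snd
  obtain ⟨e, he, hE⟩ := isSetIndex_of_primrecPred primrecPred_atomicDiagram_nameSet
  obtain ⟨a, ha, hA⟩ := isSetIndex_of_primrecPred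
    (primrecPred_mem_nameSet.and (Primrec.eq.comp (Primrec.fst.comp nm)
      (Primrec.fst.comp (Primrec.snd.comp nm))))
  obtain ⟨g, hg, hG⟩ := isSetIndex_of_primrecPred
    (primrecPred_mem_nameSet.and (Primrec.eq.comp
      (Primrec.fst.comp (Primrec.snd.comp (Primrec.snd.comp nm)))
      (Primrec.fst.comp (Primrec.snd.comp (Primrec.snd.comp (Primrec.snd.comp nm))))))
  have hA' : ∀ i, IsSetIndex (a i) (underlying (secondFactor i)) := fun i => by
    rw [underlying_secondFactor]; exact hA i
  have hG' : ∀ i, IsSetIndex (g i) (underlying (firstFactor i)) := fun i => by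
    rw [underlying_firstFactor]; exact hG i
  refine ⟨fun i => (e i, a i, g i), he.pair (ha.pair hg), fun i => ?_⟩
  exact
    { group := hE i
      setA := hA' i
      setB := hG' i
      setG := hG' i
      setH := hA' i
      sumAG := isCompl_factors i
      sumBH := (isCompl_factors i).symm
      iso := ⟨(secondFactorEquiv i).trans (firstFactorEquiv i).symm⟩
      fg := AddGroup.fg_of_surjective (f := (secondFactorEquiv i).symm.toAddMonoidHom)
        (secondFactorEquiv i).symm.surjective
      rank := by
        rw [(secondFactorEquiv i).toIntLinearEquiv.finrank_eq, Module.finrank_self] }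

/-- The name of the generator of the first factor. -/
def genName : ℕ := Encodable.encode ((1, 0, 0, 0, 0) : ℕ × ℕ × ℕ × ℕ × ℕ)

theorem nameOf_genName : nameOf genName = (1, 0, 0, 0, 0) := nameOf_encode _

attribute [irreducible] genName

/-- An isomorphism of infinite cyclic groups sends a generator to plus or minus a generator, so the
second coordinate of the image is `± nameGen i`. The sum of the two entries has the parity of their
difference. -/
theorem charFun_haltingSet_eq_of_iso {i : ℕ} (f : firstFactor i ≃+ secondFactor i)
    (x : firstFactor i) (hx : ((x : nameSet i) : ℕ) = genName) :
    charFun haltingSet i = ((nameOf ((f x : nameSet i) : ℕ)).2.2.1 +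
      (nameOf ((f x : nameSet i) : ℕ)).2.2.2.1) % 2 := by
  have hx1 : firstFactorEquiv i x = 1 := by
    change nameFst x = 1
    rw [nameFst, hx, nameOf_genName]
    rfl
  have hf : secondFactorEquiv i (f x) = 1 ∨ secondFactorEquiv i (f x) = -1 := by
    let ψ : ℤ ≃+ ℤ := ((firstFactorEquiv i).symm.trans f).trans (secondFactorEquiv i)
    have hψ : secondFactorEquiv i (f x) = ψ 1 := by
      simp [ψ, ← hx1]
    rw [hψ, ← Int.isUnit_iff]
    obtain ⟨k, hk⟩ := ψ.surjective 1
    refine IsUnit.of_mul_eq_one k ?_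
    rw [mul_comm, ← smul_eq_mul, ← map_zsmul, smul_eq_mul, mul_one, hk]
  have hsnd : nameSnd (f x : nameSet i) = nameGen i * secondFactorEquiv i (f x) :=
    (Int.mul_ediv_cancel' (nameGen_dvd (f x : nameSet i).2)).symm
  unfold nameSnd at hsnd
  unfold charFun
  by_cases hi : i ∈ haltingSet
  · rw [nameGen, if_pos hi] at hsnd
    rw [if_pos hi]
    omega
  · rw [nameGen, if_neg hi] at hsnd
    rw [if_neg hi]
    omega

theorem zeroJump_turingReducible_of_uniform {F : ℕ →. ℕ}
    (hF : ∀ (e a b g h r : ℕ) (E : Set ℕ) [AddCommGroup E] (A B G H : AddSubgroup E),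
      IsInput e a b g h r E A B G H → ∃ i ∈ F (code6 e a b g h r), IsIsoIndexOn i G H) :
    TuringReducible zeroJump F := by
  obtain ⟨s, hs, H⟩ := exists_computable_input
  have h1 : Nat.Partrec fun i => Part.some
      (code6 (s i).1 (s i).2.1 (s i).2.2 (s i).2.2 (s i).2.1 1) := by
    have s1 := Computable.fst.comp hs
    have s2 := Computable.fst.comp (Computable.snd.comp hs)
    have s3 := Computable.snd.comp (Computable.snd.comp hs)
    have p := Primrec₂.natPair.to_comp
    exact Partrec.nat_iff.1 (p.comp s1 (p.comp s2 (p.comp s3 (p.comp s3 (p.comp s2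
      (Computable.const 1))))))
  have h2 : Nat.Partrec fun j => (phi j genName).map fun w =>
      ((nameOf w).2.2.1 + (nameOf w).2.2.2.1) % 2 := by
    have c3 : Primrec fun w : ℕ => (nameOf w).2.2.1 :=
      Primrec.fst.comp (Primrec.snd.comp (Primrec.snd.comp primrec_nameOf))
    have c4 : Primrec fun w : ℕ => (nameOf w).2.2.2.1 :=
      Primrec.fst.comp (Primrec.snd.comp (Primrec.snd.comp (Primrec.snd.comp primrec_nameOf)))
    have c : Primrec fun w : ℕ => ((nameOf w).2.2.1 + (nameOf w).2.2.2.1) % 2 :=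
      Primrec.nat_mod.comp (Primrec.nat_add.comp c3 c4) (Primrec.const 2)
    exact Partrec.nat_iff.1 ((partrec₂_phi.comp Computable.id (Computable.const genName)).map
      (c.to_comp.comp Computable.snd).to₂)
  have h3 := Nat.RecursiveIn.comp (h2.recursiveIn (O := {F}))
    (Nat.RecursiveIn.comp (Nat.RecursiveIn.oracle F rfl) (h1.recursiveIn (O := {F})))
  refine RecursiveIn.iff_nat.2 (h3.of_eq fun i => ?_)
  obtain ⟨j, hj, f, hf⟩ := hF _ _ _ _ _ _ _ _ _ _ _ (H i)
  have hgen : genName ∈ nameSet i := by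
    rw [mem_nameSet, nameOf_genName]
    exact ⟨rfl, rfl, Or.inl ⟨rfl, rfl⟩⟩
  have hgen' : (⟨genName, hgen⟩ : nameSet i) ∈ firstFactor i := by
    rw [mem_firstFactor, nameAddEquiv_apply]
    simp [nameSnd, nameOf_genName]
  have := hf ⟨⟨genName, hgen⟩, hgen'⟩
  have e : (Part.some (code6 (s i).1 (s i).2.1 (s i).2.2 (s i).2.2 (s i).2.1 1)).bind F =
      Part.some j := (Part.bind_some _ _).trans (Part.eq_some_iff.2 hj)
  refine (congrArg (fun t : Part ℕ => t.bind _) e).trans ?_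
  rw [Part.bind_some, this, Part.map_some, zeroJump,
    charFun_haltingSet_eq_of_iso f ⟨⟨genName, hgen⟩, hgen'⟩ rfl]

end LowerBound

/-! ### Finite certificates for an isomorphism that fixes `G ∩ H`. -/

noncomputable section Certificates

open Finset

/-- The integer coefficients that are coded by a list of pairs of natural numbers. -/
def coef (c : List (ℕ × ℕ)) (k : ℕ) : ℤ := (c.getD k (0, 0)).1 - (c.getD k (0, 0)).2

theorem exists_coef_eq (m : ℕ) (z : ℕ → ℤ) : ∃ c, ∀ k < m, coef c k = z k := by
  refine ⟨(List.range m).map fun k => ((z k).toNat, (-z k).toNat), fun k hk => ?_⟩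
  simp only [coef, List.getD_eq_getElem?_getD, List.getElem?_map, List.getElem?_range hk,
    Option.map_some, Option.getD_some]
  omega

/-- Division of all the coefficients by `n`. -/
def divCoef (n : ℕ) (c : List (ℕ × ℕ)) : List (ℕ × ℕ) :=
  c.map fun p => ((p.1 - p.2) / n, (p.2 - p.1) / n)

/-- Truncated subtraction in both directions first replaces a pair by the reduced one with the same
difference; then the division by `n` is exact in each entry. -/
theorem coef_divCoef {n : ℕ} (hn : 1 ≤ n) {c : List (ℕ × ℕ)} {k : ℕ} {z : ℤ}
    (h : coef c k = n * z) : coef (divCoef n c) k = z := by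
  have : (divCoef n c).getD k (0, 0) = (((c.getD k (0, 0)).1 - (c.getD k (0, 0)).2) / n,
      ((c.getD k (0, 0)).2 - (c.getD k (0, 0)).1) / n) := by
    simp only [divCoef, List.getD_eq_getElem?_getD, List.getElem?_map]
    generalize (c)[k]? = o
    cases o <;> simp
  unfold coef at h ⊢
  rw [this]
  generalize (c.getD k (0, 0)).1 = p at *
  generalize (c.getD k (0, 0)).2 = q at *
  simp only
  obtain ⟨w, rfl | rfl⟩ := z.eq_nat_or_neg
  · have h1 : p = q + n * w := by exact_mod_cast (show (p : ℤ) = q + n * w by linarith)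
    subst h1
    rw [Nat.add_sub_cancel_left, Nat.sub_eq_zero_of_le (Nat.le_add_right _ _), Nat.zero_div,
      Nat.mul_div_cancel_left _ hn]
    simp
  · have h1 : q = p + n * w := by exact_mod_cast (show (q : ℤ) = p + n * w by linarith)
    subst h1
    rw [Nat.add_sub_cancel_left, Nat.sub_eq_zero_of_le (Nat.le_add_right _ _), Nat.zero_div,
      Nat.mul_div_cancel_left _ hn]
    simp

section Comb

variable {E M : Type*} [AddCommGroup E] [AddCommGroup M]

/-- An integer combination of the first `m` members of a sequence. -/
def comb (m : ℕ) (v : ℕ → E) (z : ℕ → ℤ) : E := ∑ k ∈ range m, z k • v k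

theorem comb_congr {m : ℕ} {v w : ℕ → E} {y z : ℕ → ℤ} (hv : ∀ k < m, v k = w k)
    (hz : ∀ k < m, y k = z k) : comb m v y = comb m w z :=
  sum_congr rfl fun k hk => by rw [hv k (mem_range.1 hk), hz k (mem_range.1 hk)]

theorem comb_add (m : ℕ) (v : ℕ → E) (y z : ℕ → ℤ) :
    comb m v (y + z) = comb m v y + comb m v z := by
  simp [comb, add_smul, sum_add_distrib]

theorem comb_sub (m : ℕ) (v : ℕ → E) (y z : ℕ → ℤ) :
    comb m v (y - z) = comb m v y - comb m v z := by
  simp [comb, sub_smul, sum_sub_distrib]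

theorem comb_smul (m : ℕ) (v : ℕ → E) (n : ℤ) (z : ℕ → ℤ) :
    comb m v (n • z) = n • comb m v z := by
  simp [comb, mul_smul, smul_sum]

theorem map_comb (φ : E →+ M) (m : ℕ) (v : ℕ → E) (z : ℕ → ℤ) :
    φ (comb m v z) = comb m (fun k => φ (v k)) z := by
  simp [comb]

theorem comb_mem {G : AddSubgroup E} {m : ℕ} {v : ℕ → E} (hv : ∀ k < m, v k ∈ G) (z : ℕ → ℤ) :
    comb m v z ∈ G :=
  sum_mem fun k hk => zsmul_mem (hv k (mem_range.1 hk)) _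

theorem comb_truncate {s m : ℕ} (h : s ≤ m) (v : ℕ → E) (z : ℕ → ℤ) :
    comb m v (fun k => if k < s then z k else 0) = comb s v z := by
  unfold comb
  rw [← sum_subset (range_mono h)]
  · exact sum_congr rfl fun k hk => by simp [mem_range.1 hk]
  · intro k _ hk
    simp [mem_range.not.1 hk]

theorem comb_single {k m : ℕ} (h : k < m) (v : ℕ → E) :
    comb m v (fun j => if j = k then 1 else 0) = v k := by
  unfold comb
  rw [sum_eq_single_of_mem k (mem_range.2 h)]
  · simp
  · intro j _ hj
    simp [hj]

/-- The first `m` members of a sequence are linearly independent over the integers. -/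
def Indep (m : ℕ) (v : ℕ → E) : Prop := ∀ z : ℕ → ℤ, comb m v z = 0 → ∀ k < m, z k = 0

theorem indep_iff {m : ℕ} {v : ℕ → E} :
    Indep m v ↔ LinearIndependent ℤ fun i : Fin m => v i := by
  rw [Fintype.linearIndependent_iff]
  constructor
  · intro h c hc i
    have := h (fun k => if hk : k < m then c ⟨k, hk⟩ else 0) (by
      rw [comb, sum_range, ← hc]
      exact sum_congr rfl fun i _ => by simp) i i.2
    simpa using this
  · intro h z hz k hk
    exact h (fun i => z i) (by rw [← hz, comb, sum_range]) ⟨k, hk⟩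

theorem Indep.le_finrank [Module.Finite ℤ E] {m : ℕ} {v : ℕ → E} (h : Indep m v) :
    m ≤ Module.finrank ℤ E := by
  simpa using (indep_iff.1 h).fintype_card_le_finrank

theorem Indep.extend [Module.Finite ℤ E] {s r : ℕ} {v : ℕ → E} (h : Indep s v) (hs : s ≤ r)
    (hr : r ≤ Module.finrank ℤ E) : ∃ w, Indep r w ∧ ∀ k < s, w k = v k := by
  induction r, hs using Nat.le_induction with
  | base => exact ⟨v, h, fun _ _ => rfl⟩
  | succ r hs ih =>
    obtain ⟨w, hw, hwv⟩ := ih (Nat.le_of_succ_le hr)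
    obtain ⟨x, hx⟩ := exists_linearIndependent_snoc_of_lt_rank (indep_iff.1 hw)
      (Module.lt_rank_of_lt_finrank hr)
    refine ⟨Function.update w r x, indep_iff.2 ?_, fun k hk => ?_⟩
    · have : (fun i : Fin (r + 1) => Function.update w r x i) =
          Fin.snoc (α := fun _ => E) (fun i : Fin r => w i) x := by
        funext i
        refine Fin.lastCases ?_ (fun j => ?_) i
        · simp
        · simp [j.2.ne]
      rw [this]
      exact hx
    · rw [Function.update_of_ne (hk.trans_le hs).ne, hwv k hk]

/-- Otherwise `v` followed by `x` would be independent of length `r + 1`. The sign of the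
coefficient of `x` in a relation accounts for the two cases. -/
theorem Indep.exists_relation [Module.Finite ℤ E] {r : ℕ} {v : ℕ → E} (h : Indep r v)
    (hr : Module.finrank ℤ E = r) (x : E) : ∃ n : ℕ, 1 ≤ n ∧ ∃ y, n • x = comb r v y := by
  by_contra! hcon
  have : Indep (r + 1) (Function.update v r x) := by
    intro z hz
    have hz' : comb r v z + z r • x = 0 := by
      rw [comb, sum_range_succ, Function.update_self] at hz
      rw [← hz, comb]
      congr 1
      exact sum_congr rfl fun k hk => by rw [Function.update_of_ne (mem_range.1 hk).ne]
    have hzr : z r = 0 := by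
      by_contra hne
      obtain ⟨n, hn⟩ := (z r).eq_nat_or_neg
      have hn1 : 1 ≤ n := by omega
      rcases hn with hn | hn
      · refine hcon n hn1 ((-1 : ℤ) • z) ?_
        rw [comb_smul, neg_one_smul, ← natCast_zsmul, ← hn]
        exact (neg_eq_of_add_eq_zero_right hz').symm
      · refine hcon n hn1 z ?_
        rw [hn, neg_smul, natCast_zsmul, add_neg_eq_zero] at hz'
        exact hz'.symm
    rw [hzr, zero_smul, add_zero] at hz'
    intro k hk
    rcases Nat.lt_succ_iff_lt_or_eq.1 hk with hk | rfl
    · exact h z hz' k hk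
    · exact hzr
  have := this.le_finrank
  omega

end Comb

section Cert

variable {E : Type} [AddCommGroup E]

/-- A finite certificate for the facts that `g k ↦ h k` extends by the identity of `G ∩ H` to a
homomorphism and that its domain is all of `G`. -/
structure HalfCert (G H B : AddSubgroup E) (r m N : ℕ) (g h b : ℕ → E) : Prop where
  le : r ≤ m
  mem_b : ∀ j < r, b j ∈ B
  indep : ∀ y, comb r b (coef y) = 0 → ∀ j < r, coef y j = 0
  mem_g : ∀ k < m, g k ∈ G
  compat : ∀ c, comb m g (coef c) ∈ H → comb m g (coef c) = comb m h (coef c)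
  gen : ∀ x ∈ G, ∀ n : ℕ, 1 ≤ n → ∀ y, n • x - comb r b (coef y) ∈ H →
    ∃ i < N, x - comb r g (coef (divCoef n y)) - comb m g (coef (Denumerable.ofNat _ i)) ∈ H

theorem exists_proj {B H : AddSubgroup E} (h : IsCompl B H) :
    ∃ π : E →+ B, (∀ x, π x = 0 ↔ x ∈ H) ∧ ∀ b : B, π b = b := by
  have key : ∀ x : E, x = ((addEquivOfIsCompl h).symm x).1 + ((addEquivOfIsCompl h).symm x).2 := by
    intro x
    conv_lhs => rw [← (addEquivOfIsCompl h).apply_symm_apply x]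
    rfl
  refine ⟨(AddMonoidHom.fst B H).comp (addEquivOfIsCompl h).symm.toAddMonoidHom, fun x => ?_,
    fun b => ?_⟩
  · constructor
    · intro hx
      have hx' : ((addEquivOfIsCompl h).symm x).1 = 0 := hx
      rw [key x, hx', ZeroMemClass.coe_zero, zero_add]
      exact SetLike.coe_mem _
    · intro hx
      have : (addEquivOfIsCompl h).symm x = (0, ⟨x, hx⟩) := by
        rw [AddEquiv.symm_apply_eq]; simp
      exact congrArg Prod.fst this
  · have : (addEquivOfIsCompl h).symm b = (b, 0) := by
      rw [AddEquiv.symm_apply_eq]; simp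
    exact congrArg Prod.fst this

namespace HalfCert

variable {G H A B : AddSubgroup E} {r m N : ℕ} {g h b a : ℕ → E}

theorem compat' (C : HalfCert G H B r m N g h b) (z : ℕ → ℤ) (hz : comb m g z ∈ H) :
    comb m g z = comb m h z := by
  obtain ⟨c, hc⟩ := exists_coef_eq m z
  have e1 : comb m g z = comb m g (coef c) := comb_congr (fun _ _ => rfl) fun k hk => (hc k hk).symm
  have e2 : comb m h z = comb m h (coef c) := comb_congr (fun _ _ => rfl) fun k hk => (hc k hk).symm
  rw [e1, e2]
  exact C.compat c (e1 ▸ hz)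

/-- The `r` independent elements `b j` are maximal in `B` because `r` is the rank, so a multiple of
the projection of `x` to `B` is a combination of them. This provides the hypothesis of the clause
`gen`. -/
theorem exists_comb (C : HalfCert G H B r m N g h b) (hBH : IsCompl B H) [Module.Finite ℤ B]
    (hr : Module.finrank ℤ B = r) {x : E} (hx : x ∈ G) : ∃ z, x - comb m g z ∈ H := by
  obtain ⟨π, hπ, hπB⟩ := exists_proj hBH
  have hb : ∀ j < r, ((π (b j) : B) : E) = b j := fun j hj => by
    rw [hπB ⟨b j, C.mem_b j hj⟩]
  have hind : Indep r fun j => π (b j) := by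
    intro z hz
    obtain ⟨y, hy⟩ := exists_coef_eq r z
    have : comb r b (coef y) = 0 := by
      have := congrArg B.subtype hz
      rw [map_comb, map_zero] at this
      rw [← this]
      exact comb_congr (fun j hj => (hb j hj).symm) hy
    intro k hk
    rw [← hy k hk]
    exact C.indep y this k hk
  obtain ⟨n, hn, y, hy⟩ := hind.exists_relation hr (π x)
  obtain ⟨y', hy'⟩ := exists_coef_eq r y
  have h1 : n • x - comb r b (coef y') ∈ H := by
    rw [← hπ, map_sub, map_nsmul, hy, map_comb, sub_eq_zero]
    exact comb_congr (fun _ _ => rfl) fun k hk => (hy' k hk).symm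
  obtain ⟨i, -, hi⟩ := C.gen x hx n hn y' h1
  refine ⟨(fun k => if k < r then coef (divCoef n y') k else 0) + coef (Denumerable.ofNat _ i), ?_⟩
  rw [comb_add, comb_truncate C.le, ← sub_sub]
  exact hi

/-- The value `x - ∑ z k • g k + ∑ z k • h k` does not depend on `z`: two choices differ by a
combination of the `g k` that lies in `H`, to which `compat` applies. The other half gives the
inverse by the same formula with `g` and `h` exchanged. -/
theorem exists_addEquiv (C : HalfCert G H B r m N g h b) (D : HalfCert H G A r m N h g a)
    (hC : ∀ x ∈ G, ∃ z, x - comb m g z ∈ H) (hD : ∀ x ∈ H, ∃ z, x - comb m h z ∈ G) :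
    ∃ f : G ≃+ H, ∀ (x : G) (z : ℕ → ℤ), (x : E) - comb m g z ∈ H →
      (f x : E) = x - comb m g z + comb m h z := by
  choose p hp using fun x : G => hC x x.2
  choose q hq using fun x : H => hD x x.2
  have hgG := fun z => comb_mem C.mem_g z
  have hhH := fun z => comb_mem D.mem_g z
  have up : ∀ (x : E) (y z : ℕ → ℤ), x - comb m g y ∈ H → x - comb m g z ∈ H →
      x - comb m g y + comb m h y = x - comb m g z + comb m h z := by
    intro x y z hy hz
    have h1 : comb m g (y - z) ∈ H := by
      rw [comb_sub]
      have := sub_mem hz hy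
      simpa using this
    have h2 := C.compat' _ h1
    rw [comb_sub, comb_sub] at h2
    have h3 : comb m g y = comb m g z + (comb m h y - comb m h z) := by rw [← h2]; abel
    rw [h3]; abel
  have uq : ∀ (x : E) (y z : ℕ → ℤ), x - comb m h y ∈ G → x - comb m h z ∈ G →
      x - comb m h y + comb m g y = x - comb m h z + comb m g z := by
    intro x y z hy hz
    have h1 : comb m h (y - z) ∈ G := by
      rw [comb_sub]
      have := sub_mem hz hy
      simpa using this
    have h2 := D.compat' _ h1
    rw [comb_sub, comb_sub] at h2
    have h3 : comb m h y = comb m h z + (comb m g y - comb m g z) := by rw [← h2]; abel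
    rw [h3]; abel
  let f : G → H := fun x => ⟨x - comb m g (p x) + comb m h (p x), add_mem (hp x) (hhH _)⟩
  let f' : H → G := fun x => ⟨x - comb m h (q x) + comb m g (q x), add_mem (hq x) (hgG _)⟩
  have hf : ∀ (x : G) z, (x : E) - comb m g z ∈ H → (f x : E) = x - comb m g z + comb m h z :=
    fun x z hz => up x _ _ (hp x) hz
  have hf' : ∀ (x : H) z, (x : E) - comb m h z ∈ G → (f' x : E) = x - comb m h z + comb m g z :=
    fun x z hz => uq x _ _ (hq x) hz
  refine ⟨⟨⟨f, f', fun x => ?_, fun x => ?_⟩, fun x y => ?_⟩, hf⟩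
  · have h1 : (f x : E) - comb m h (p x) = x - comb m g (p x) := by simp [f]
    refine Subtype.ext ?_
    rw [hf' (f x) (p x) (h1 ▸ sub_mem x.2 (hgG _)), h1]
    abel
  · have h1 : (f' x : E) - comb m g (q x) = x - comb m h (q x) := by simp [f']
    refine Subtype.ext ?_
    rw [hf (f' x) (q x) (h1 ▸ sub_mem x.2 (hhH _)), h1]
    abel
  · refine Subtype.ext ?_
    have h1 : ((x + y : G) : E) - comb m g (p x + p y) ∈ H := by
      rw [comb_add]
      have := add_mem (hp x) (hp y)
      rw [AddSubgroup.coe_add]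
      convert this using 1
      abel
    change (f (x + y) : E) = f x + f y
    rw [hf _ _ h1, comb_add, comb_add]
    simp only [f, AddSubgroup.coe_add]
    abel

end HalfCert

theorem exists_generators (L : Type) [AddCommGroup L] [AddGroup.FG L] :
    ∃ (s q : ℕ) (l : ℕ → L) (t : ℕ → L), Indep s l ∧ (∀ k < q, ∃ M : ℕ, 1 ≤ M ∧ M • t k = 0) ∧
      ∀ x, ∃ z, ∃ k < q, x = comb s l z + t k := by
  classical
  obtain ⟨s, ι, _, p, hp, e, ⟨i⟩⟩ := AddCommGroup.equiv_free_prod_directSum_zmod L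
  have hfin : Finite (DirectSum ι fun j => ZMod (p j ^ e j)) := by
    have : ∀ j, NeZero (p j ^ e j) := fun j => ⟨pow_ne_zero _ (hp j).ne_zero⟩
    exact Finite.of_equiv _ (DirectSum.addEquivProd fun j => ZMod (p j ^ e j)).symm.toEquiv
  obtain ⟨q, ⟨u⟩⟩ := Finite.exists_equiv_fin (DirectSum ι fun j => ZMod (p j ^ e j))
  let l : ℕ → L := fun k => if hk : k < s then i.symm (Finsupp.single ⟨k, hk⟩ 1, 0) else 0
  let t : ℕ → L := fun k => if hk : k < q then i.symm (0, u.symm ⟨k, hk⟩) else 0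
  have hl : ∀ z : ℕ → ℤ, i (comb s l z) = (Finsupp.equivFunOnFinite.symm fun j : Fin s => z j, 0) := by
    intro z
    rw [comb, sum_range, map_sum]
    have : ∀ j : Fin s, i (z j • l j) = (Finsupp.single j (z j), 0) := fun j => by
      simp [l]
    simp only [this]
    refine Prod.ext ?_ ?_
    · rw [Prod.fst_sum]
      simp only
      ext j
      simp [Finsupp.finsetSum_apply, Finsupp.single_apply]
    · rw [Prod.snd_sum]
      simp
  refine ⟨s, q, l, t, ?_, ?_, ?_⟩
  · intro z hz k hk
    have := hl z
    rw [hz, map_zero] at this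
    have := DFunLike.congr_fun (congrArg Prod.fst this) (⟨k, hk⟩ : Fin s)
    simpa using this.symm
  · intro k hk
    have : Fintype (DirectSum ι fun j => ZMod (p j ^ e j)) := Fintype.ofFinite _
    refine ⟨Fintype.card (DirectSum ι fun j => ZMod (p j ^ e j)), Fintype.card_pos, ?_⟩
    apply i.injective
    simp [t, hk]
  · intro x
    refine ⟨fun k => if hk : k < s then (i x).1 ⟨k, hk⟩ else 0, u (i x).2, (u (i x).2).2, ?_⟩
    apply i.injective
    rw [map_add, hl]
    refine Prod.ext ?_ ?_
    · ext j
      simp [t]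
    · simp [t]

/-- The projections to `B` of the first `s` members of `g` are independent and extend to the `r`
elements `b j`. Since `b` begins with them, the coefficients of `n • x` in terms of `b` reveal the
free coordinates of `x`, and one torsion generator `g k` accounts for the rest. Any larger `N` also
works, so two halves can share one bound. -/
theorem HalfCert.of_generators {G H B : AddSubgroup E} (hBH : IsCompl B H) [Module.Finite ℤ B]
    {s r m : ℕ} (hr : Module.finrank ℤ B = r) (hsr : s ≤ r) (hrm : r ≤ m) {g h : ℕ → E}
    (hg : ∀ k, g k ∈ G) (hcompat : ∀ z, comb m g z ∈ H → comb m g z = comb m h z)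
    (hind : ∀ z, comb s g z ∈ H → ∀ k < s, z k = 0)
    (hgen : ∀ x ∈ G, ∃ z, ∃ k < m, (∃ M : ℕ, 1 ≤ M ∧ M • g k ∈ H) ∧ x - comb s g z - g k ∈ H) :
    ∃ N₀ b, ∀ N, N₀ ≤ N → HalfCert G H B r m N g h b := by
  obtain ⟨π, hπ, hπB⟩ := exists_proj hBH
  have hind' : Indep s fun k => π (g k) := by
    intro z hz
    rw [← map_comb, hπ] at hz
    exact hind z hz
  obtain ⟨b, hb, hbg⟩ := hind'.extend hsr hr.ge
  -- The list `c k` codes the `k`-th unit vector, so its combination is `g k`; `N₀` exceeds the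
  -- codes of all these lists.
  choose c hc using fun k => exists_coef_eq m fun j => if j = k then 1 else 0
  refine ⟨(range m).sup (fun k => Encodable.encode (c k)) + 1, fun k => b k, fun N hN => ?_⟩
  refine ⟨hrm, fun j _ => (b j).2, fun y hy => ?_, fun k _ => hg k, fun z => hcompat _, ?_⟩
  · refine hb _ (Subtype.ext ?_)
    have := map_comb B.subtype r b (coef y)
    exact this.trans hy
  · intro x hx n hn y hy
    obtain ⟨z, k, hk, ⟨M, hM, hMk⟩, hzk⟩ := hgen x hx
    have e1 : n • π x = comb r b (coef y) := by
      rw [← hπ, map_sub, map_nsmul, map_comb, sub_eq_zero] at hy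
      rw [hy]
      exact comb_congr (fun j _ => hπB (b j)) fun _ _ => rfl
    have e2 : π x = comb r b (fun j => if j < s then z j else 0) + π (g k) := by
      rw [← hπ, map_sub, map_sub, map_comb, sub_sub, sub_eq_zero] at hzk
      rw [hzk, comb_truncate hsr]
      congr 1
      exact comb_congr (fun j hj => (hbg j hj).symm) fun _ _ => rfl
    have e3 : M • π (g k) = 0 := by rw [← map_nsmul]; exact (hπ _).2 hMk
    -- Multiplication by `M` kills the torsion part, and independence of `b` then forces `y = n z`,
    -- with `z` continued by zero from `s` to `r`.
    have e4 : comb r b ((M : ℤ) • ((n : ℤ) • (fun j => if j < s then z j else 0) - coef y)) = 0 := by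
      rw [comb_smul, comb_sub, comb_smul, ← e1, eq_sub_of_add_eq e2.symm, smul_sub, smul_sub,
        smul_sub]
      simp only [natCast_zsmul]
      rw [smul_comm M n (π (g k)), e3, smul_zero]
      abel
    have e5 : ∀ j < r, coef y j = n * (if j < s then z j else 0) := by
      intro j hj
      have h0 := hb _ e4 j hj
      simp only [Pi.smul_apply, Pi.sub_apply, smul_eq_mul, mul_eq_zero] at h0
      rcases h0 with h0 | h0
      · omega
      · linarith
    refine ⟨Encodable.encode (c k), lt_of_lt_of_le (Nat.lt_succ_of_le
      (le_sup (f := fun k => Encodable.encode (c k)) (mem_range.2 hk))) hN, ?_⟩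
    rw [Denumerable.ofNat_encode]
    have e6 : comb r g (coef (divCoef n y)) = comb s g z := by
      rw [← comb_truncate hsr]
      exact comb_congr (fun _ _ => rfl) fun j hj => coef_divCoef hn (e5 j hj)
    have e7 : comb m g (coef (c k)) = g k := by
      rw [← comb_single hk g]
      exact comb_congr (fun _ _ => rfl) fun j hj => hc k j hj
    rw [e6, e7]
    exact hzk

/-- The projection along `H` maps `G` to `B` with kernel `G ∩ H`. Its image is finitely generated,
being a subgroup of `B`; lifts of generators serve as `g`, and `f ∘ g` serves as `h`. The second
half follows by transport along `f`, which fixes `G ∩ H`. -/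
theorem exists_halfCert {A B G H : AddSubgroup E} (hAG : IsCompl A G)
    (hBH : IsCompl B H) (i : A ≃+ B) (hA : AddGroup.FG A) {r : ℕ} (hr : Module.finrank ℤ A = r) :
    ∃ m N g h b a, HalfCert G H B r m N g h b ∧ HalfCert H G A r m N h g a := by
  obtain ⟨f, hf⟩ := exists_equiv_of_isCompl_of_fg hAG hBH i hA
  have hAfin : Module.Finite ℤ A := Module.Finite.iff_addGroup_fg.2 hA
  have hBfin : Module.Finite ℤ B := Module.Finite.equiv i.toIntLinearEquiv
  have hrB : Module.finrank ℤ B = r := by rw [← hr, i.toIntLinearEquiv.finrank_eq]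
  obtain ⟨π, hπ, hπB⟩ := exists_proj hBH
  let ρ : G →+ B := π.comp G.subtype
  have hρ : ∀ x : G, ρ x = 0 ↔ (x : E) ∈ H := fun x => hπ x
  have hfg : AddGroup.FG ρ.range := by
    have : IsNoetherian ℤ B := inferInstance
    have h1 : (AddSubgroup.toIntSubmodule ρ.range).FG := IsNoetherian.noetherian _
    have h2 : Module.Finite ℤ (AddSubgroup.toIntSubmodule ρ.range) := Module.Finite.of_fg h1
    exact Module.Finite.iff_addGroup_fg.1 h2
  obtain ⟨s, q, l, t, hl, ht, hlt⟩ := exists_generators ρ.range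
  choose gl hgl using fun k => (l k).2
  choose gt hgt using fun k => (t k).2
  have hls : Indep s fun k => ((l k : ρ.range) : B) := by
    intro z hz
    refine hl z (Subtype.ext ?_)
    exact (map_comb ρ.range.subtype s l z).trans hz
  have hsr : s ≤ r := hrB ▸ hls.le_finrank
  -- The first `r` places contain lifts of the free generators, with the places from `s` to `r` as
  -- mere padding; the torsion lifts come after them.
  let g : ℕ → G := fun k => if k < r then gl k else gt (k - r)
  have hcg : ∀ m z, comb m (fun k => ((g k : G) : E)) z = (comb m g z : G) := fun m z =>
    (map_comb G.subtype m g z).symm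
  have hch : ∀ m z, comb m (fun k => ((f (g k) : H) : E)) z = (f (comb m g z) : H) := fun m z => by
    have h1 := map_comb f.toAddMonoidHom m g z
    have h2 := map_comb H.subtype m (fun k => f (g k)) z
    exact h2.symm.trans (congrArg _ h1.symm)
  have hfix : ∀ x : G, (x : E) ∈ H → (f x : E) = x := fun x hx => by
    rw [hf x ⟨x, hx⟩ rfl]
  -- If `f x ∈ G`, then `f` fixes `f x`, so injectivity gives `f x = x`. Thus the inverse of `f`
  -- fixes `G ∩ H` as well.
  have hfix' : ∀ x : G, (f x : E) ∈ G → (f x : E) = x := fun x hx => by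
    have h1 : f ⟨f x, hx⟩ = f x := hf _ _ rfl
    exact congrArg Subtype.val (f.injective h1)
  have hindg : ∀ z, comb s (fun k => ((g k : G) : E)) z ∈ H → ∀ k < s, z k = 0 := by
    intro z hz
    rw [hcg, ← hρ, map_comb] at hz
    refine hls z ?_
    rw [← hz]
    refine comb_congr (fun k hk => ?_) fun _ _ => rfl
    simp [g, hk.trans_le hsr, hgl]
  have hgeng : ∀ x : G, ∃ z, ∃ k < r + q, (∃ M : ℕ, 1 ≤ M ∧ ((M • g k : G) : E) ∈ H) ∧
      ((x - comb s g z - g k : G) : E) ∈ H := by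
    intro x
    obtain ⟨z, k, hk, hzk⟩ := hlt ⟨ρ x, x, rfl⟩
    have hgk : ρ (g (r + k)) = t k := by simp [g, hgt]
    refine ⟨z, r + k, by omega, ?_, ?_⟩
    · obtain ⟨M, hM, hMt⟩ := ht k hk
      refine ⟨M, hM, ?_⟩
      rw [← hρ, map_nsmul, hgk]
      exact congrArg Subtype.val hMt
    · rw [← hρ, map_sub, map_sub, hgk, map_comb, sub_sub, sub_eq_zero]
      have h1 : ρ x = ρ.range.subtype (comb s l z) + t k := congrArg Subtype.val hzk
      rw [h1, map_comb]
      congr 1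
      refine comb_congr (fun k hk => ?_) fun _ _ => rfl
      simp [g, hk.trans_le hsr, hgl]
  obtain ⟨N₁, b, hb⟩ := HalfCert.of_generators (G := G) hBH hrB hsr (Nat.le_add_right r q)
    (g := fun k => g k) (h := fun k => f (g k)) (fun k => (g k).2)
    (fun z hz => by rw [hcg] at hz; rw [hcg, hch, hfix _ hz]) hindg
    (fun x hx => by
      obtain ⟨z, k, hk, ⟨M, hM, hMk⟩, h⟩ := hgeng ⟨x, hx⟩
      refine ⟨z, k, hk, ⟨M, hM, hMk⟩, ?_⟩
      rw [hcg]
      exact h)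
  obtain ⟨N₂, a, ha⟩ := HalfCert.of_generators (G := H) hAG hr hsr (Nat.le_add_right r q)
    (g := fun k => f (g k)) (h := fun k => g k) (fun k => (f (g k)).2)
    (fun z hz => by rw [hch] at hz; rw [hcg, hch, hfix' _ hz])
    (fun z hz => by
      rw [hch] at hz
      refine hindg z ?_
      rw [hcg, ← hfix' _ hz]
      exact (f _).2)
    (fun x hx => by
      obtain ⟨z, k, hk, ⟨M, hM, hMk⟩, h⟩ := hgeng (f.symm ⟨x, hx⟩)
      refine ⟨z, k, hk, ⟨M, hM, ?_⟩, ?_⟩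
      · have h1 := hfix _ hMk
        rw [map_nsmul] at h1
        have h2 : M • ((f (g k) : H) : E) = ((M • g k : G) : E) := h1
        rw [h2]
        exact (M • g k).2
      · have h1 := hfix _ h
        rw [map_sub, map_sub, f.apply_symm_apply] at h1
        rw [hch]
        have h2 : x - (f (comb s g z) : E) - (f (g k) : E) =
          ((f.symm ⟨x, hx⟩ - comb s g z - g k : G) : E) := h1
        rw [h2]
        exact SetLike.coe_mem _)
  exact ⟨r + q, max N₁ N₂, _, _, b, a, hb _ (le_max_left _ _), ha _ (le_max_right _ _)⟩

end Cert

end Certificates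

/-! ### Arithmetic in a group given by its atomic diagram, and the refutation of certificates. -/

noncomputable section Machine

/-- Search for the sum of `x` and `y` in the group with index `e`. -/
def addP (e x y : ℕ) : Part ℕ :=
  Nat.rfind fun z => (phi e (2 * Nat.pair (Nat.pair x y) z + 1)).map fun v => decide (v = 1)

/-- Search for the difference of `x` and `y` in the group with index `e`. -/
def subP (e x y : ℕ) : Part ℕ :=
  Nat.rfind fun z => (phi e (2 * Nat.pair (Nat.pair z y) x + 1)).map fun v => decide (v = 1)

/-- Search for the neutral element of the group with index `e`. -/
def zeroP (e : ℕ) : Part ℕ :=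
  Nat.rfind fun z => (phi e (2 * Nat.pair (Nat.pair z z) z + 1)).map fun v => decide (v = 1)

/-- Computation of the multiple `n • x` in the group with index `e`. -/
def nsmulP (e n x : ℕ) : Part ℕ :=
  n.rec (zeroP e) fun _ IH => IH.bind fun s => addP e s x

/-- Computation of an integer multiple in the group with index `e`. -/
def smulP (e : ℕ) (p : ℕ × ℕ) (x : ℕ) : Part ℕ :=
  (nsmulP e p.1 x).bind fun u => (nsmulP e p.2 x).bind fun v => subP e u v

/-- Computation of an integer combination in the group with index `e`. -/
def combP (e m : ℕ) (v : List ℕ) (c : List (ℕ × ℕ)) : Part ℕ :=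
  m.rec (zeroP e) fun k IH => IH.bind fun s =>
    (smulP e (c.getD k (0, 0)) (v.getD k 0)).bind fun t => addP e s t

section Partrec

variable {α : Type*} [Primcodable α]

theorem computable_eq_decide {f g : α → ℕ} (hf : Computable f) (hg : Computable g) :
    Computable fun a => decide (f a = g a) :=
  (Primrec.eq (α := ℕ)).decide.to_comp.comp hf hg

theorem partrec_rfind_sum {e : α → ℕ} {x y z : α × ℕ → ℕ} (he : Computable e) (hx : Computable x)
    (hy : Computable y) (hz : Computable z) : Partrec fun a => Nat.rfind fun n =>
      (phi (e a) (2 * Nat.pair (Nat.pair (x (a, n)) (y (a, n))) (z (a, n)) + 1)).map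
        fun v => decide (v = 1) := by
  refine Partrec.rfind (p := fun a n =>
      (phi (e a) (2 * Nat.pair (Nat.pair (x (a, n)) (y (a, n))) (z (a, n)) + 1)).map
        fun v => decide (v = 1)) (Partrec.map (partrec₂_phi.comp (he.comp Computable.fst) ?_)
      (computable_eq_decide Computable.snd (Computable.const 1)).to₂)
  exact Primrec.nat_double_succ.to_comp.comp (Primrec₂.natPair.to_comp.comp
    (Primrec₂.natPair.to_comp.comp hx hy) hz)

theorem partrec_addP {e x y : α → ℕ} (he : Computable e) (hx : Computable x) (hy : Computable y) :
    Partrec fun a => addP (e a) (x a) (y a) :=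
  partrec_rfind_sum (x := fun q => x q.1) (y := fun q => y q.1) (z := fun q => q.2) he
    (hx.comp Computable.fst) (hy.comp Computable.fst) Computable.snd

theorem partrec_subP {e x y : α → ℕ} (he : Computable e) (hx : Computable x) (hy : Computable y) :
    Partrec fun a => subP (e a) (x a) (y a) :=
  partrec_rfind_sum (x := fun q => q.2) (y := fun q => y q.1) (z := fun q => x q.1) he
    Computable.snd (hy.comp Computable.fst) (hx.comp Computable.fst)

theorem partrec_zeroP {e : α → ℕ} (he : Computable e) : Partrec fun a => zeroP (e a) :=
  partrec_rfind_sum (x := fun q => q.2) (y := fun q => q.2) (z := fun q => q.2) he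
    Computable.snd Computable.snd Computable.snd

theorem partrec_nsmulP {e n x : α → ℕ} (he : Computable e) (hn : Computable n)
    (hx : Computable x) : Partrec fun a => nsmulP (e a) (n a) (x a) :=
  Partrec.nat_rec (h := fun a (q : ℕ × ℕ) => addP (e a) q.2 (x a)) hn (partrec_zeroP he)
    (partrec_addP (he.comp Computable.fst) (Computable.snd.comp Computable.snd)
      (hx.comp Computable.fst)).to₂

theorem partrec_smulP {e : α → ℕ} {p : α → ℕ × ℕ} {x : α → ℕ} (he : Computable e)
    (hp : Computable p) (hx : Computable x) : Partrec fun a => smulP (e a) (p a) (x a) := by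
  refine (partrec_nsmulP he (Computable.fst.comp hp) hx).bind (g := fun a u =>
    (nsmulP (e a) (p a).2 (x a)).bind fun v => subP (e a) u v) ?_
  refine (partrec_nsmulP he (Computable.snd.comp hp) hx).comp Computable.fst |>.bind
    (g := fun a v => subP (e a.1) a.2 v) ?_
  exact partrec_subP (he.comp (Computable.fst.comp Computable.fst))
    (Computable.snd.comp Computable.fst) Computable.snd

theorem partrec_combP {e m : α → ℕ} {v : α → List ℕ} {c : α → List (ℕ × ℕ)} (he : Computable e)
    (hm : Computable m) (hv : Computable v) (hc : Computable c) :
    Partrec fun a => combP (e a) (m a) (v a) (c a) := by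
  refine Partrec.nat_rec (h := fun a (q : ℕ × ℕ) =>
    (smulP (e a) ((c a).getD q.1 (0, 0)) ((v a).getD q.1 0)).bind fun t => addP (e a) q.2 t)
    hm (partrec_zeroP he) ?_
  have hk : Computable fun q : α × ℕ × ℕ => q.2.1 := Computable.fst.comp Computable.snd
  refine Partrec.bind (g := fun (q : α × ℕ × ℕ) t => addP (e q.1) q.2.2 t)
    (partrec_smulP (he.comp Computable.fst)
    ((Primrec.list_getD (0, 0)).to_comp.comp (hc.comp Computable.fst) hk)
    ((Primrec.list_getD 0).to_comp.comp (hv.comp Computable.fst) hk)) ?_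
  exact partrec_addP (he.comp (Computable.fst.comp Computable.fst))
    (Computable.snd.comp (Computable.snd.comp Computable.fst)) Computable.snd

theorem primrec_divCoef : Primrec₂ divCoef := by
  have hp : Primrec fun q : (ℕ × List (ℕ × ℕ)) × ℕ × ℕ => q.2.1 := Primrec.fst.comp Primrec.snd
  have hq : Primrec fun q : (ℕ × List (ℕ × ℕ)) × ℕ × ℕ => q.2.2 := Primrec.snd.comp Primrec.snd
  have hn : Primrec fun q : (ℕ × List (ℕ × ℕ)) × ℕ × ℕ => q.1.1 := Primrec.fst.comp Primrec.fst
  exact Primrec.list_map Primrec.snd (g := fun (q : ℕ × List (ℕ × ℕ)) (p : ℕ × ℕ) =>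
    ((p.1 - p.2) / q.1, (p.2 - p.1) / q.1))
    ((Primrec.nat_div.comp (Primrec.nat_sub.comp hp hq) hn).pair
      (Primrec.nat_div.comp (Primrec.nat_sub.comp hq hp) hn))

end Partrec

section Correct

theorem rfind_eq_some {p : ℕ →. Bool} {w : ℕ} (h : ∀ z, p z = Part.some (decide (z = w))) :
    Nat.rfind p = Part.some w := by
  rw [Part.eq_some_iff, Nat.mem_rfind]
  refine ⟨by simp [h], fun {k} hk => by simp [h, hk.ne]⟩

variable {E : Set ℕ} [AddCommGroup E] {e : ℕ}

theorem sum_mem_atomicDiagram {a b c : ℕ} :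
    2 * Nat.pair (Nat.pair a b) c + 1 ∈ atomicDiagram E ↔
      ∃ x y : E, a = x ∧ b = y ∧ c = (x + y : E) := by
  constructor
  · rintro (⟨x, hx⟩ | ⟨x, y, hxy⟩)
    · omega
    · have h1 : Nat.pair (Nat.pair a b) c = Nat.pair (Nat.pair x y) (x + y : E) := by omega
      rw [Nat.pair_eq_pair, Nat.pair_eq_pair] at h1
      exact ⟨x, y, h1.1.1, h1.1.2, h1.2⟩
  · rintro ⟨x, y, rfl, rfl, rfl⟩
    exact Or.inr ⟨x, y, rfl⟩

theorem rfind_sum_eq_some (he : IsGroupIndex e E) {x y z : ℕ → ℕ} {w : ℕ}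
    (h : ∀ n, (∃ u v : E, x n = u ∧ y n = v ∧ z n = (u + v : E)) ↔ n = w) :
    (Nat.rfind fun n => (phi e (2 * Nat.pair (Nat.pair (x n) (y n)) (z n) + 1)).map
      fun v => decide (v = 1)) = Part.some w := by
  refine rfind_eq_some fun n => ?_
  rw [he, Part.map_some, charFun]
  simp only [sum_mem_atomicDiagram, h]
  by_cases hn : n = w <;> simp [hn]

theorem addP_coe (he : IsGroupIndex e E) (x y : E) : addP e x y = Part.some ((x + y : E) : ℕ) := by
  refine rfind_sum_eq_some he fun n => ⟨?_, ?_⟩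
  · rintro ⟨u, v, hu, hv, rfl⟩
    rw [Subtype.ext hu, Subtype.ext hv]
  · rintro rfl
    exact ⟨x, y, rfl, rfl, rfl⟩

theorem subP_coe (he : IsGroupIndex e E) (x y : E) : subP e x y = Part.some ((x - y : E) : ℕ) := by
  refine rfind_sum_eq_some he fun n => ⟨?_, ?_⟩
  · rintro ⟨u, v, rfl, hv, hx⟩
    rw [Subtype.ext hv, Subtype.ext hx, add_sub_cancel_right]
  · rintro rfl
    exact ⟨x - y, y, rfl, rfl, by rw [sub_add_cancel]⟩

theorem zeroP_eq (he : IsGroupIndex e E) : zeroP e = Part.some ((0 : E) : ℕ) := by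
  refine rfind_sum_eq_some he fun n => ⟨?_, ?_⟩
  · rintro ⟨u, v, rfl, hv, hx⟩
    have h1 : u = u + v := Subtype.ext hx
    have h2 : u = v := Subtype.ext hv
    rw [h2, left_eq_add.1 h1]
  · rintro rfl
    exact ⟨0, 0, rfl, rfl, by rw [add_zero]⟩

theorem nsmulP_coe (he : IsGroupIndex e E) (n : ℕ) (x : E) :
    nsmulP e n x = Part.some ((n • x : E) : ℕ) := by
  induction n with
  | zero => simpa [nsmulP] using zeroP_eq he
  | succ n ih =>
    have h : nsmulP e (n + 1) x = (nsmulP e n x).bind fun s => addP e s x := rfl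
    rw [h, ih, Part.bind_some, addP_coe he, succ_nsmul]

theorem smulP_coe (he : IsGroupIndex e E) (p : ℕ × ℕ) (x : E) :
    smulP e p x = Part.some (((p.1 - p.2 : ℤ) • x : E) : ℕ) := by
  rw [smulP, nsmulP_coe he, Part.bind_some, nsmulP_coe he, Part.bind_some, subP_coe he, sub_smul,
    natCast_zsmul, natCast_zsmul]

theorem combP_coe (he : IsGroupIndex e E) {m : ℕ} {v : List ℕ} {w : ℕ → E}
    (h : ∀ k < m, v.getD k 0 = w k) (c : List (ℕ × ℕ)) :
    combP e m v c = Part.some ((comb m w (coef c) : E) : ℕ) := by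
  induction m with
  | zero => simpa [combP, comb] using zeroP_eq he
  | succ m ih =>
    have h' : combP e (m + 1) v c = (combP e m v c).bind fun s =>
      (smulP e (c.getD m (0, 0)) (v.getD m 0)).bind fun t => addP e s t := rfl
    rw [h', ih fun k hk => h k (hk.trans (Nat.lt_succ_self m)), Part.bind_some,
      h m (Nat.lt_succ_self m), smulP_coe he, Part.bind_some, addP_coe he, comb, comb,
      Finset.sum_range_succ]
    rfl

theorem coe_mem_underlying {S : AddSubgroup E} {x : E} : (x : ℕ) ∈ underlying S ↔ x ∈ S :=
  ⟨fun ⟨_, hy, hyx⟩ => Subtype.ext hyx ▸ hy, fun h => ⟨x, h, rfl⟩⟩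

theorem one_mem_phi_iff {i : ℕ} {S : Set ℕ} (h : IsSetIndex i S) {n : ℕ} : 1 ∈ phi i n ↔ n ∈ S := by
  rw [h, Part.mem_some_iff, charFun]
  split_ifs with hn <;> simp [hn]

theorem zero_mem_phi_iff {i : ℕ} {S : Set ℕ} (h : IsSetIndex i S) {n : ℕ} :
    0 ∈ phi i n ↔ n ∉ S := by
  rw [h, Part.mem_some_iff, charFun]
  split_ifs with hn <;> simp [hn]

end Correct

/-- The evidence that some data do not form a certificate; it can be found by a search. -/
def Fails (e G H B r m N : ℕ) (g h b : List ℕ) : Prop :=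
  m < r ∨
  (∃ j, j < r ∧ 0 ∈ phi B (b.getD j 0)) ∨
  (∃ k, k < m ∧ 0 ∈ phi G (g.getD k 0)) ∨
  (∃ w : List (ℕ × ℕ) × ℕ × ℕ, w.2.1 < r ∧
    ¬ (w.1.getD w.2.1 (0, 0)).1 = (w.1.getD w.2.1 (0, 0)).2 ∧
    w.2.2 ∈ zeroP e ∧ w.2.2 ∈ combP e r b w.1) ∨
  (∃ w : List (ℕ × ℕ) × ℕ × ℕ, ¬ w.2.1 = w.2.2 ∧ w.2.1 ∈ combP e m g w.1 ∧
    w.2.2 ∈ combP e m h w.1 ∧ 1 ∈ phi H w.2.1) ∨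
  (∃ w : List (ℕ × ℕ) × ℕ × ℕ, 1 ≤ w.2.1 ∧ 1 ∈ phi G w.2.2 ∧
    1 ∈ ((nsmulP e w.2.1 w.2.2).bind fun u => (combP e r b w.1).bind fun v =>
      (subP e u v).bind fun d => phi H d) ∧
    ∀ i < N, 0 ∈ ((combP e r g (divCoef w.2.1 w.1)).bind fun u =>
      (combP e m g (Denumerable.ofNat _ i)).bind fun v => (subP e w.2.2 u).bind fun t =>
        (subP e t v).bind fun d => phi H d))

section Search

variable {α : Type*} [Primcodable α]

theorem REPred.of_decide {p : α → Prop} [DecidablePred p]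
    (hp : Computable fun a => decide (p a)) : REPred p :=
  (Computable.computablePred hp).to_re

/-- Non-membership is expressed by the value `0` of a characteristic function, hence is a positive
event. The only universal quantifier is bounded by `N`. -/
theorem rePred_fails {e G H B r m N : α → ℕ} {g h b : α → List ℕ} (he : Computable e)
    (hG : Computable G) (hH : Computable H) (hB : Computable B) (hr : Computable r)
    (hm : Computable m) (hN : Computable N) (hg : Computable g) (hh : Computable h)
    (hb : Computable b) :
    REPred fun a => Fails (e a) (G a) (H a) (B a) (r a) (m a) (N a) (g a) (h a) (b a) := by
  have lt {β : Type _} [Primcodable β] {f g : β → ℕ} (hf : Computable f) (hg : Computable g) :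
      REPred fun a => f a < g a := REPred.of_decide (Primrec.nat_lt.decide.to_comp.comp hf hg)
  have ne {β : Type _} [Primcodable β] {f g : β → ℕ} (hf : Computable f) (hg : Computable g) :
      REPred fun a => ¬ f a = g a :=
    REPred.of_decide ((Primrec.not.to_comp.comp (computable_eq_decide hf hg)).of_eq
      fun a => by simp)
  have getN {β : Type _} [Primcodable β] {l : β → List ℕ} {k : β → ℕ} (hl : Computable l)
      (hk : Computable k) : Computable fun a => (l a).getD (k a) 0 :=
    (Primrec.list_getD 0).to_comp.comp hl hk
  let W := List (ℕ × ℕ) × ℕ × ℕ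
  have p0 {β : Type _} [Primcodable β] {f : α → β} (hf : Computable f) :
      Computable fun x : α × W => f x.1 := hf.comp Computable.fst
  have w1 : Computable fun x : α × W => x.2.1 := Computable.fst.comp Computable.snd
  have w2 : Computable fun x : α × W => x.2.2.1 :=
    Computable.fst.comp (Computable.snd.comp Computable.snd)
  have w3 : Computable fun x : α × W => x.2.2.2 :=
    Computable.snd.comp (Computable.snd.comp Computable.snd)
  refine (lt hm hr).or (REPred.or ?_ (REPred.or ?_ (REPred.or ?_ (REPred.or ?_ ?_))))
  · refine REPred.ex (p := fun a j => j < r a ∧ 0 ∈ phi (B a) ((b a).getD j 0)) ?_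
    exact (lt Computable.snd (hr.comp Computable.fst)).and
      (REPred.mem (partrec₂_phi.comp (hB.comp Computable.fst)
        (getN (hb.comp Computable.fst) Computable.snd)) (Computable.const 0))
  · refine REPred.ex (p := fun a k => k < m a ∧ 0 ∈ phi (G a) ((g a).getD k 0)) ?_
    exact (lt Computable.snd (hm.comp Computable.fst)).and
      (REPred.mem (partrec₂_phi.comp (hG.comp Computable.fst)
        (getN (hg.comp Computable.fst) Computable.snd)) (Computable.const 0))
  · refine REPred.ex (p := fun a (w : W) => w.2.1 < r a ∧
      ¬ (w.1.getD w.2.1 (0, 0)).1 = (w.1.getD w.2.1 (0, 0)).2 ∧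
      w.2.2 ∈ zeroP (e a) ∧ w.2.2 ∈ combP (e a) (r a) (b a) w.1) ?_
    have hget : Computable fun x : α × W => x.2.1.getD x.2.2.1 (0, 0) :=
      (Primrec.list_getD ((0 : ℕ), (0 : ℕ))).to_comp.comp w1 w2
    exact (lt w2 (p0 hr)).and ((ne (Computable.fst.comp hget) (Computable.snd.comp hget)).and
      ((REPred.mem (partrec_zeroP (p0 he)) w3).and
        (REPred.mem (partrec_combP (p0 he) (p0 hr) (p0 hb) w1) w3)))
  · refine REPred.ex (p := fun a (w : W) => ¬ w.2.1 = w.2.2 ∧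
      w.2.1 ∈ combP (e a) (m a) (g a) w.1 ∧ w.2.2 ∈ combP (e a) (m a) (h a) w.1 ∧
      1 ∈ phi (H a) w.2.1) ?_
    exact (ne w2 w3).and ((REPred.mem (partrec_combP (p0 he) (p0 hm) (p0 hg) w1) w2).and
      ((REPred.mem (partrec_combP (p0 he) (p0 hm) (p0 hh) w1) w3).and
        (REPred.mem (partrec₂_phi.comp (p0 hH) w2) (Computable.const 1))))
  · refine REPred.ex (p := fun a (w : W) => 1 ≤ w.2.1 ∧ 1 ∈ phi (G a) w.2.2 ∧
      1 ∈ ((nsmulP (e a) w.2.1 w.2.2).bind fun u => (combP (e a) (r a) (b a) w.1).bind fun v =>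
        (subP (e a) u v).bind fun d => phi (H a) d) ∧
      ∀ i < N a, 0 ∈ ((combP (e a) (r a) (g a) (divCoef w.2.1 w.1)).bind fun u =>
        (combP (e a) (m a) (g a) (Denumerable.ofNat _ i)).bind fun v =>
          (subP (e a) w.2.2 u).bind fun t => (subP (e a) t v).bind fun d => phi (H a) d)) ?_
    refine (lt (Computable.const 0) w2).and ((REPred.mem (partrec₂_phi.comp (p0 hG) w3)
      (Computable.const 1)).and ((REPred.mem ?_ (Computable.const 1)).and
        (REPred.ball_lt ?_ (p0 hN))))
    · refine Partrec.bind (g := fun (x : α × W) u => (combP (e x.1) (r x.1) (b x.1) x.2.1).bind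
        fun v => (subP (e x.1) u v).bind fun d => phi (H x.1) d)
        (partrec_nsmulP (p0 he) w2 w3) ?_
      refine Partrec.bind (g := fun (x : (α × W) × ℕ) v =>
        (subP (e x.1.1) x.2 v).bind fun d => phi (H x.1.1) d)
        ((partrec_combP (p0 he) (p0 hr) (p0 hb) w1).comp Computable.fst) ?_
      refine Partrec.bind (g := fun (x : ((α × W) × ℕ) × ℕ) d => phi (H x.1.1.1) d)
        (partrec_subP ((p0 he).comp (Computable.fst.comp Computable.fst))
          (Computable.snd.comp Computable.fst) Computable.snd) ?_
      exact partrec₂_phi.comp ((p0 hH).comp (Computable.fst.comp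
        (Computable.fst.comp Computable.fst))) Computable.snd
    · refine REPred.mem ?_ (Computable.const 0)
      have q {β : Type _} [Primcodable β] {f : α × W → β} (hf : Computable f) :
        Computable fun x : (α × W) × ℕ => f x.1 := hf.comp Computable.fst
      refine Partrec.bind (g := fun (x : (α × W) × ℕ) u =>
        (combP (e x.1.1) (m x.1.1) (g x.1.1) (Denumerable.ofNat _ x.2)).bind fun v =>
          (subP (e x.1.1) x.1.2.2.2 u).bind fun t =>
            (subP (e x.1.1) t v).bind fun d => phi (H x.1.1) d)
        (partrec_combP (q (f := fun x => e x.1) (p0 he)) (q (f := fun x => r x.1) (p0 hr))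
          (q (f := fun x => g x.1) (p0 hg))
          (q (f := fun x => divCoef x.2.2.1 x.2.1) (primrec_divCoef.to_comp.comp w2 w1))) ?_
      refine Partrec.bind (g := fun (x : ((α × W) × ℕ) × ℕ) v =>
          (subP (e x.1.1.1) x.1.1.2.2.2 x.2).bind fun t =>
            (subP (e x.1.1.1) t v).bind fun d => phi (H x.1.1.1) d)
        ((partrec_combP (q (f := fun x => e x.1) (p0 he)) (q (f := fun x => m x.1) (p0 hm))
          (q (f := fun x => g x.1) (p0 hg))
          ((Computable.ofNat (List (ℕ × ℕ))).comp Computable.snd)).comp Computable.fst) ?_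
      have q' {β : Type _} [Primcodable β] {f : α × W → β} (hf : Computable f) :
        Computable fun x : (((α × W) × ℕ) × ℕ) × ℕ => f x.1.1.1 :=
        hf.comp (Computable.fst.comp (Computable.fst.comp Computable.fst))
      refine Partrec.bind (g := fun (x : (((α × W) × ℕ) × ℕ) × ℕ) t =>
            (subP (e x.1.1.1.1) t x.2).bind fun d => phi (H x.1.1.1.1) d)
        (partrec_subP (q' (f := fun x => e x.1) (p0 he)) (q' (f := fun x => x.2.2.2) w3) (Computable.snd.comp Computable.fst)) ?_
      refine Partrec.bind (g := fun (x : ((((α × W) × ℕ) × ℕ) × ℕ) × ℕ) d => phi (H x.1.1.1.1.1) d)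
        (partrec_subP ((q' (f := fun x => e x.1) (p0 he)).comp Computable.fst) Computable.snd
          (Computable.snd.comp Computable.fst)) ?_
      exact partrec₂_phi.comp ((q' (f := fun x => H x.1) (p0 hH)).comp (Computable.fst.comp Computable.fst))
        Computable.snd

end Search

section FailsCorrect

variable {E : Set ℕ} [AddCommGroup E] {e iG iH iB r m N : ℕ} {G H B : AddSubgroup E}
  {g h b : List ℕ}

theorem le_of_not_fails (hF : ¬ Fails e iG iH iB r m N g h b) : r ≤ m := by
  by_contra hlt
  exact hF (Or.inl (not_le.1 hlt))

theorem mem_of_not_fails_left (hF : ¬ Fails e iG iH iB r m N g h b)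
    (hB : IsSetIndex iB (underlying B)) {j : ℕ} (hj : j < r) : b.getD j 0 ∈ underlying B := by
  by_contra hn
  exact hF (Or.inr (Or.inl ⟨j, hj, (zero_mem_phi_iff hB).2 hn⟩))

theorem mem_of_not_fails_right (hF : ¬ Fails e iG iH iB r m N g h b)
    (hG : IsSetIndex iG (underlying G)) {k : ℕ} (hk : k < m) : g.getD k 0 ∈ underlying G := by
  by_contra hn
  exact hF (Or.inr (Or.inr (Or.inl ⟨k, hk, (zero_mem_phi_iff hG).2 hn⟩)))

/-- Once the list entries are known to name elements of `E`, all the searches in `Fails` terminate,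
and its clauses become the negations of the clauses of the certificate. The three preceding lemmas
supply this knowledge for data that are not refuted. -/
theorem halfCert_iff_not_fails (he : IsGroupIndex e E) (hG : IsSetIndex iG (underlying G))
    (hH : IsSetIndex iH (underlying H)) (hB : IsSetIndex iB (underlying B)) (hrm : r ≤ m)
    {g' h' b' : ℕ → E} (hg : ∀ k < m, g.getD k 0 = g' k) (hh : ∀ k < m, h.getD k 0 = h' k)
    (hb : ∀ k < r, b.getD k 0 = b' k) :
    HalfCert G H B r m N g' h' b' ↔ ¬ Fails e iG iH iB r m N g h b := by
  have hgr : ∀ k < r, g.getD k 0 = g' k := fun k hk => hg k (hk.trans_le hrm)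
  have f1 : (∃ j, j < r ∧ 0 ∈ phi iB (b.getD j 0)) ↔ ¬ ∀ j < r, b' j ∈ B := by
    push Not
    refine exists_congr fun j => and_congr_right fun hj => ?_
    rw [zero_mem_phi_iff hB, hb j hj, coe_mem_underlying]
  have f2 : (∃ k, k < m ∧ 0 ∈ phi iG (g.getD k 0)) ↔ ¬ ∀ k < m, g' k ∈ G := by
    push Not
    refine exists_congr fun j => and_congr_right fun hj => ?_
    rw [zero_mem_phi_iff hG, hg j hj, coe_mem_underlying]
  have f3 : (∃ w : List (ℕ × ℕ) × ℕ × ℕ, w.2.1 < r ∧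
      ¬ (w.1.getD w.2.1 (0, 0)).1 = (w.1.getD w.2.1 (0, 0)).2 ∧
      w.2.2 ∈ zeroP e ∧ w.2.2 ∈ combP e r b w.1) ↔
      ¬ ∀ y, comb r b' (coef y) = 0 → ∀ j < r, coef y j = 0 := by
    push Not
    simp only [zeroP_eq he, combP_coe he hb, Part.mem_some_iff]
    constructor
    · rintro ⟨⟨y, j, z⟩, h1, h2, h3, h4⟩
      refine ⟨y, Subtype.ext (h4.symm.trans h3), j, h1, fun h0 => h2 ?_⟩
      have := sub_eq_zero.1 h0
      exact_mod_cast this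
    · rintro ⟨y, h1, j, h2, h3⟩
      refine ⟨⟨y, j, ((0 : E) : ℕ)⟩, h2, fun h0 => h3 ?_, rfl, by rw [h1]⟩
      exact sub_eq_zero.2 (by exact_mod_cast h0)
  have f4 : (∃ w : List (ℕ × ℕ) × ℕ × ℕ, ¬ w.2.1 = w.2.2 ∧ w.2.1 ∈ combP e m g w.1 ∧
      w.2.2 ∈ combP e m h w.1 ∧ 1 ∈ phi iH w.2.1) ↔
      ¬ ∀ c, comb m g' (coef c) ∈ H → comb m g' (coef c) = comb m h' (coef c) := by
    push Not
    simp only [combP_coe he hg, combP_coe he hh, Part.mem_some_iff, one_mem_phi_iff hH]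
    constructor
    · rintro ⟨⟨c, u, v⟩, h1, h2, h3, h4⟩
      dsimp only at h1 h2 h3 h4
      rw [h2, coe_mem_underlying] at h4
      refine ⟨c, h4, fun h0 => h1 ?_⟩
      rw [h2, h3, h0]
    · rintro ⟨c, h1, h2⟩
      exact ⟨⟨c, _, _⟩, fun h0 => h2 (Subtype.ext h0), rfl, rfl, coe_mem_underlying.2 h1⟩
  have f5 : (∃ w : List (ℕ × ℕ) × ℕ × ℕ, 1 ≤ w.2.1 ∧ 1 ∈ phi iG w.2.2 ∧
      1 ∈ ((nsmulP e w.2.1 w.2.2).bind fun u => (combP e r b w.1).bind fun v =>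
        (subP e u v).bind fun d => phi iH d) ∧
      ∀ i < N, 0 ∈ ((combP e r g (divCoef w.2.1 w.1)).bind fun u =>
        (combP e m g (Denumerable.ofNat _ i)).bind fun v => (subP e w.2.2 u).bind fun t =>
          (subP e t v).bind fun d => phi iH d)) ↔
      ¬ ∀ x ∈ G, ∀ n : ℕ, 1 ≤ n → ∀ y, n • x - comb r b' (coef y) ∈ H →
        ∃ i < N, x - comb r g' (coef (divCoef n y)) -
          comb m g' (coef (Denumerable.ofNat _ i)) ∈ H := by
    push Not
    simp only [combP_coe he hg, combP_coe he hgr, combP_coe he hb, Part.bind_some,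
      one_mem_phi_iff hG]
    constructor
    · rintro ⟨⟨y, n, x⟩, h1, ⟨x, hx, rfl⟩, h3, h4⟩
      simp only [nsmulP_coe he, subP_coe he, Part.bind_some, one_mem_phi_iff hH,
        zero_mem_phi_iff hH, coe_mem_underlying] at h3 h4
      exact ⟨x, hx, n, h1, y, h3, h4⟩
    · rintro ⟨x, hx, n, h1, y, h3, h4⟩
      refine ⟨⟨y, n, x⟩, h1, ⟨x, hx, rfl⟩, ?_⟩
      simp only [nsmulP_coe he, subP_coe he, Part.bind_some, one_mem_phi_iff hH,
        zero_mem_phi_iff hH, coe_mem_underlying]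
      exact ⟨h3, h4⟩
  rw [Fails, f1, f2, f3, f4, f5]
  constructor
  · intro C hF
    rcases hF with hF | hF | hF | hF | hF | hF
    · omega
    · exact hF C.mem_b
    · exact hF C.mem_g
    · exact hF C.indep
    · exact hF C.compat
    · exact hF C.gen
  · intro hF
    push Not at hF
    exact ⟨hrm, hF.2.1, hF.2.2.2.1, hF.2.2.1, hF.2.2.2.2.1, hF.2.2.2.2.2⟩

end FailsCorrect

end Machine

/-! ### Upper bound: the search with the halting set as oracle. -/

noncomputable section UpperBound

/-- The test whether subtracting the `i`-th combination of `g` moves the element `x` of `G`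
into `H`. -/
def isoTest (e G H m : ℕ) (g : List ℕ) (x i : ℕ) : Part Bool :=
  (phi G x).bind fun t => (combP e m g (Denumerable.ofNat _ i)).bind fun u =>
    (subP e x u).bind fun d => (phi H d).map fun s => decide (t * s = 1)

/-- The partial function that exchanges the generators `g` for `h` and fixes `G ∩ H`. -/
def isoP (e G H m : ℕ) (g h : List ℕ) (x : ℕ) : Part ℕ :=
  (Nat.rfind fun i => isoTest e G H m g x i).bind fun i =>
    (combP e m g (Denumerable.ofNat _ i)).bind fun u =>
      (combP e m h (Denumerable.ofNat _ i)).bind fun v =>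
        (subP e x u).bind fun d => addP e d v

section Partrec

variable {α : Type*} [Primcodable α] {e G H m x i : α → ℕ} {g h : α → List ℕ}

theorem partrec_isoTest (he : Computable e) (hG : Computable G) (hH : Computable H)
    (hm : Computable m) (hg : Computable g) (hx : Computable x) (hi : Computable i) :
    Partrec fun a => isoTest (e a) (G a) (H a) (m a) (g a) (x a) (i a) := by
  refine Partrec.bind (g := fun a t => (combP (e a) (m a) (g a) (Denumerable.ofNat _ (i a))).bind
    fun u => (subP (e a) (x a) u).bind fun d => (phi (H a) d).map fun s => decide (t * s = 1))
    (partrec₂_phi.comp hG hx) ?_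
  refine Partrec.bind (g := fun (q : α × ℕ) u => (subP (e q.1) (x q.1) u).bind fun d =>
    (phi (H q.1) d).map fun s => decide (q.2 * s = 1))
    ((partrec_combP he hm hg ((Computable.ofNat (List (ℕ × ℕ))).comp hi)).comp Computable.fst) ?_
  refine Partrec.bind (g := fun (q : (α × ℕ) × ℕ) d =>
    (phi (H q.1.1) d).map fun s => decide (q.1.2 * s = 1))
    (partrec_subP (e := fun q : (α × ℕ) × ℕ => e q.1.1) (x := fun q => x q.1.1) (y := fun q => q.2)
      (he.comp (Computable.fst.comp Computable.fst))
      (hx.comp (Computable.fst.comp Computable.fst)) Computable.snd) ?_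
  refine Partrec.map (f := fun q : ((α × ℕ) × ℕ) × ℕ => phi (H q.1.1.1) q.2)
    (g := fun q s => decide (q.1.1.2 * s = 1))
    (partrec₂_phi.comp (hH.comp (Computable.fst.comp (Computable.fst.comp Computable.fst)))
      Computable.snd) ?_
  exact computable_eq_decide (Primrec.nat_mul.to_comp.comp (Computable.snd.comp (Computable.fst.comp
    (Computable.fst.comp Computable.fst))) Computable.snd) (Computable.const 1)

theorem partrec₂_isoP (he : Computable e) (hG : Computable G) (hH : Computable H)
    (hm : Computable m) (hg : Computable g) (hh : Computable h) :
    Partrec₂ fun a x => isoP (e a) (G a) (H a) (m a) (g a) (h a) x := by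
  have c {β : Type _} [Primcodable β] {f : α → β} (hf : Computable f) :
      Computable fun q : (α × ℕ) × ℕ => f q.1.1 := hf.comp (Computable.fst.comp Computable.fst)
  have ci : Computable fun q : (α × ℕ) × ℕ => Denumerable.ofNat (List (ℕ × ℕ)) q.2 :=
    (Computable.ofNat (List (ℕ × ℕ))).comp Computable.snd
  refine Partrec.bind (g := fun (q : α × ℕ) i =>
    (combP (e q.1) (m q.1) (g q.1) (Denumerable.ofNat _ i)).bind fun u =>
      (combP (e q.1) (m q.1) (h q.1) (Denumerable.ofNat _ i)).bind fun v =>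
        (subP (e q.1) q.2 u).bind fun d => addP (e q.1) d v)
    (Partrec.rfind (p := fun (q : α × ℕ) i =>
      isoTest (e q.1) (G q.1) (H q.1) (m q.1) (g q.1) q.2 i) ?_) ?_
  · exact partrec_isoTest (c he) (c hG) (c hH) (c hm) (c hg) (Computable.snd.comp Computable.fst)
      Computable.snd
  refine Partrec.bind (g := fun (q : (α × ℕ) × ℕ) u =>
      (combP (e q.1.1) (m q.1.1) (h q.1.1) (Denumerable.ofNat _ q.2)).bind fun v =>
        (subP (e q.1.1) q.1.2 u).bind fun d => addP (e q.1.1) d v)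
    (partrec_combP (c he) (c hm) (c hg) ci) ?_
  refine Partrec.bind (g := fun (q : ((α × ℕ) × ℕ) × ℕ) v =>
        (subP (e q.1.1.1) q.1.1.2 q.2).bind fun d => addP (e q.1.1.1) d v)
    ((partrec_combP (c he) (c hm) (c hh) ci).comp Computable.fst) ?_
  refine Partrec.bind (g := fun (q : (((α × ℕ) × ℕ) × ℕ) × ℕ) d => addP (e q.1.1.1.1) d q.2)
    (partrec_subP (e := fun q : (((α × ℕ) × ℕ) × ℕ) × ℕ => e q.1.1.1.1) (x := fun q => q.1.1.1.2) (y := fun q => q.1.2)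
      (he.comp (Computable.fst.comp (Computable.fst.comp (Computable.fst.comp Computable.fst))))
      (Computable.snd.comp (Computable.fst.comp (Computable.fst.comp Computable.fst)))
      (Computable.snd.comp Computable.fst)) ?_
  exact partrec_addP (e := fun q : ((((α × ℕ) × ℕ) × ℕ) × ℕ) × ℕ => e q.1.1.1.1.1) (x := fun q => q.2) (y := fun q => q.1.2)
    (he.comp (Computable.fst.comp (Computable.fst.comp (Computable.fst.comp
      (Computable.fst.comp Computable.fst)))))
    Computable.snd (Computable.snd.comp Computable.fst)

end Partrec

section Correct

variable {E : Set ℕ} [AddCommGroup E] {e iG iH m : ℕ} {G H : AddSubgroup E} {g h : List ℕ}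

theorem charFun_eq_one_iff {S : Set ℕ} {n : ℕ} : charFun S n = 1 ↔ n ∈ S := by
  unfold charFun
  split_ifs with hn <;> simp [hn]

/-- This keeps numbers outside the universe `E` out of the domain of the computed isomorphism. -/
theorem mem_of_mem_subP (he : IsGroupIndex e E) {x u d : ℕ} (hd : d ∈ subP e x u) :
    x ∈ E := by
  have h1 := Nat.rfind_spec hd
  rw [he, Part.map_some, Part.mem_some_iff, charFun] at h1
  split_ifs at h1 with h2
  · obtain ⟨-, y, -, -, rfl⟩ := sum_mem_atomicDiagram.1 h2
    exact Subtype.coe_prop _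
  · simp at h1

/-- Every successful index yields the same value `f x`, by `hf`. Success also requires `n` to lie in
`E`, by the subtraction, and in `G`, by the factor `t` of the test, so the domain is exactly `G`. -/
theorem mem_isoP_iff (he : IsGroupIndex e E) (hG : IsSetIndex iG (underlying G))
    (hH : IsSetIndex iH (underlying H)) {g' h' : ℕ → E} (hg : ∀ k < m, g.getD k 0 = g' k)
    (hh : ∀ k < m, h.getD k 0 = h' k) (hspan : ∀ x ∈ G, ∃ z, x - comb m g' z ∈ H)
    {f : G ≃+ H} (hf : ∀ (x : G) (z : ℕ → ℤ), (x : E) - comb m g' z ∈ H →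
      (f x : E) = x - comb m g' z + comb m h' z) {n k : ℕ} :
    k ∈ isoP e iG iH m g h n ↔ ∃ x : G, ((x : E) : ℕ) = n ∧ ((f x : E) : ℕ) = k := by
  have htest : ∀ (x : E) (i : ℕ), isoTest e iG iH m g x i = Part.some
      (decide (charFun (underlying G) x *
        charFun (underlying H) (x - comb m g' (coef (Denumerable.ofNat _ i)) : E) = 1)) := by
    intro x i
    rw [isoTest, hG, Part.bind_some, combP_coe he hg, Part.bind_some, subP_coe he, Part.bind_some,
      hH, Part.map_some]
  have htrue : ∀ (x : E) (i : ℕ), true ∈ isoTest e iG iH m g x i ↔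
      x ∈ G ∧ x - comb m g' (coef (Denumerable.ofNat _ i)) ∈ H := by
    intro x i
    rw [htest, Part.mem_some_iff, eq_comm, decide_eq_true_iff, mul_eq_one, charFun_eq_one_iff,
      charFun_eq_one_iff, coe_mem_underlying, coe_mem_underlying]
  have hval : ∀ x : G, isoP e iG iH m g h (x : E) = Part.some ((f x : E) : ℕ) := by
    intro x
    obtain ⟨z, hz⟩ := hspan x x.2
    obtain ⟨c, hc⟩ := exists_coef_eq m z
    have hzc : comb m g' (coef c) = comb m g' z := comb_congr (fun _ _ => rfl) hc
    -- Minimization also needs the test to be defined at all smaller indices; for `x` in `E` it is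
    -- defined everywhere.
    have hdom : (Nat.rfind fun i => isoTest e iG iH m g (x : E) i).Dom := by
      refine Nat.rfind_dom.2 ⟨Encodable.encode c, (htrue _ _).2 ⟨x.2, ?_⟩, fun {i} _ => by rw [htest]; trivial⟩
      rw [Denumerable.ofNat_encode, hzc]
      exact hz
    obtain ⟨i, hi⟩ := Part.dom_iff_mem.1 hdom
    have hspec := ((htrue _ _).1 (Nat.rfind_spec hi)).2
    rw [isoP, Part.eq_some_iff.2 hi, Part.bind_some, combP_coe he hg, Part.bind_some,
      combP_coe he hh, Part.bind_some, subP_coe he, Part.bind_some, addP_coe he, hf x _ hspec]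
  constructor
  · intro hk
    obtain ⟨i, hi, -⟩ := Part.mem_bind_iff.1 hk
    have hi' := Nat.rfind_spec hi
    have hn : n ∈ E := by
      obtain ⟨t, -, h2⟩ := Part.mem_bind_iff.1 hi'
      obtain ⟨u, -, h3⟩ := Part.mem_bind_iff.1 h2
      obtain ⟨d, hd, -⟩ := Part.mem_bind_iff.1 h3
      exact mem_of_mem_subP he hd
    have hx := ((htrue ⟨n, hn⟩ i).1 hi').1
    refine ⟨⟨⟨n, hn⟩, hx⟩, rfl, ?_⟩
    have := hval ⟨⟨n, hn⟩, hx⟩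
    change isoP e iG iH m g h n = _ at this
    rw [this, Part.mem_some_iff] at hk
    exact hk.symm
  · rintro ⟨x, rfl, rfl⟩
    rw [hval, Part.mem_some_iff]

end Correct

/-- The six arguments. -/
abbrev Input := ℕ × ℕ × ℕ × ℕ × ℕ × ℕ

/-- The data of a certificate: two numbers, the generators of `G` and of `H`, and the maximal
independent lists of `B` and of `A`. -/
abbrev Data := ℕ × ℕ × List ℕ × List ℕ × List ℕ × List ℕ

/-- The data are refuted. -/
def Refuted (q : Input × Data) : Prop :=
  Fails q.1.1 q.1.2.2.2.1 q.1.2.2.2.2.1 q.1.2.2.1 q.1.2.2.2.2.2 q.2.1 q.2.2.1 q.2.2.2.1 q.2.2.2.2.1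
    q.2.2.2.2.2.1 ∨
  Fails q.1.1 q.1.2.2.2.2.1 q.1.2.2.2.1 q.1.2.1 q.1.2.2.2.2.2 q.2.1 q.2.2.1 q.2.2.2.2.1 q.2.2.2.1
    q.2.2.2.2.2.2

theorem exists_not_refuted {e a b g h r : ℕ} {E : Set ℕ} [AddCommGroup E]
    {A B G H : AddSubgroup E} (hI : IsInput e a b g h r E A B G H) :
    ∃ d, ¬ Refuted ((e, a, b, g, h, r), d) := by
  obtain ⟨i⟩ := hI.iso
  obtain ⟨m, N, g', h', b', a', C, D⟩ := exists_halfCert hI.sumAG hI.sumBH i hI.fg hI.rank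
  let L : (ℕ → E) → List ℕ := fun v => (List.range m).map fun k => (v k : ℕ)
  have hL : ∀ v, ∀ k < m, (L v).getD k 0 = v k := by
    intro v k hk
    simp [L, List.getD_eq_getElem?_getD, List.getElem?_map, List.getElem?_range hk]
  have hLr : ∀ v, ∀ k < r, (L v).getD k 0 = v k := fun v k hk => hL v k (hk.trans_le C.le)
  refine ⟨(m, N, L g', L h', L b', L a'), ?_⟩
  rintro (hF | hF)
  · exact (halfCert_iff_not_fails hI.group hI.setG hI.setH hI.setB C.le (hL g') (hL h')
      (hLr b')).1 C hF
  · exact (halfCert_iff_not_fails hI.group hI.setH hI.setG hI.setA C.le (hL h') (hL g')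
      (hLr a')).1 D hF

/-- The partial function computed from the data. -/
def isoOf (q : Input × Data) (x : ℕ) : Part ℕ :=
  isoP q.1.1 q.1.2.2.2.1 q.1.2.2.2.2.1 q.2.1 q.2.2.2.1 q.2.2.2.2.1 x

/-- The data need not be those built in `exists_halfCert`: any data that escape refutation form a
pair of certificates, which is enough. Membership of the entries `g` is checked in the first half
and that of `h` in the second. -/
theorem exists_addEquiv_of_not_refuted {e a b g h r : ℕ} {E : Set ℕ} [AddCommGroup E]
    {A B G H : AddSubgroup E} (hI : IsInput e a b g h r E A B G H) {d : Data}
    (hd : ¬ Refuted ((e, a, b, g, h, r), d)) :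
    ∃ f : G ≃+ H, ∀ n m : ℕ, m ∈ isoOf ((e, a, b, g, h, r), d) n ↔
      ∃ x : G, ((x : E) : ℕ) = n ∧ ((f x : E) : ℕ) = m := by
  obtain ⟨m, N, gs, hs, bs, as⟩ := d
  obtain ⟨h1, h2⟩ := not_or.1 hd
  dsimp only at h1 h2
  have key : ∀ (S : AddSubgroup E) (v : List ℕ) (l : ℕ), (∀ k < l, v.getD k 0 ∈ underlying S) →
      ∃ w : ℕ → E, ∀ k < l, v.getD k 0 = w k := by
    intro S v l hv
    refine ⟨fun k => if hk : k < l then (hv k hk).choose else 0, fun k hk => ?_⟩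
    simp only [hk, dif_pos]
    exact (hv k hk).choose_spec.2.symm
  obtain ⟨g', hg'⟩ := key G gs m fun k hk => mem_of_not_fails_right h1 hI.setG hk
  obtain ⟨h', hh'⟩ := key H hs m fun k hk => mem_of_not_fails_right h2 hI.setH hk
  obtain ⟨b', hb'⟩ := key B bs r fun k hk => mem_of_not_fails_left h1 hI.setB hk
  obtain ⟨a', ha'⟩ := key A as r fun k hk => mem_of_not_fails_left h2 hI.setA hk
  have hrm := le_of_not_fails h1
  have C := (halfCert_iff_not_fails hI.group hI.setG hI.setH hI.setB hrm hg' hh' hb').2 h1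
  have D := (halfCert_iff_not_fails hI.group hI.setH hI.setG hI.setA hrm hh' hg' ha').2 h2
  obtain ⟨i⟩ := hI.iso
  have hAfin : Module.Finite ℤ A := Module.Finite.iff_addGroup_fg.2 hI.fg
  have hBfin : Module.Finite ℤ B := Module.Finite.equiv i.toIntLinearEquiv
  have hrB : Module.finrank ℤ B = r := by rw [← hI.rank, i.toIntLinearEquiv.finrank_eq]
  have spanG : ∀ x ∈ G, ∃ z, x - comb m g' z ∈ H := fun x hx => C.exists_comb hI.sumBH hrB hx
  have spanH : ∀ x ∈ H, ∃ z, x - comb m h' z ∈ G := fun x hx => D.exists_comb hI.sumAG hI.rank hx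
  obtain ⟨f, hf⟩ := C.exists_addEquiv D spanG spanH
  exact ⟨f, fun n k => mem_isoP_iff hI.group hI.setG hI.setH hg' hh' spanG hf⟩

theorem rePred_refuted : REPred Refuted := by
  have i1 : Computable fun q : Input × Data => q.1 := Computable.fst
  have e := Computable.fst.comp i1
  have i2 := Computable.snd.comp i1
  have a := Computable.fst.comp i2
  have i3 := Computable.snd.comp i2
  have b := Computable.fst.comp i3
  have i4 := Computable.snd.comp i3
  have g := Computable.fst.comp i4
  have i5 := Computable.snd.comp i4
  have h := Computable.fst.comp i5
  have r := Computable.snd.comp i5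
  have d1 : Computable fun q : Input × Data => q.2 := Computable.snd
  have m := Computable.fst.comp d1
  have d2 := Computable.snd.comp d1
  have N := Computable.fst.comp d2
  have d3 := Computable.snd.comp d2
  have gs := Computable.fst.comp d3
  have d4 := Computable.snd.comp d3
  have hs := Computable.fst.comp d4
  have d5 := Computable.snd.comp d4
  have bs := Computable.fst.comp d5
  have as := Computable.snd.comp d5
  exact (rePred_fails e g h b r m N gs hs bs).or (rePred_fails e h g a r m N hs gs as)

theorem partrec₂_isoOf : Partrec₂ isoOf := by
  have i1 : Computable fun q : Input × Data => q.1 := Computable.fst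
  have e := Computable.fst.comp i1
  have i4 := Computable.snd.comp (Computable.snd.comp (Computable.snd.comp i1))
  have g := Computable.fst.comp i4
  have h := Computable.fst.comp (Computable.snd.comp i4)
  have d1 : Computable fun q : Input × Data => q.2 := Computable.snd
  have m := Computable.fst.comp d1
  have d3 := Computable.snd.comp (Computable.snd.comp d1)
  have gs := Computable.fst.comp d3
  have hs := Computable.fst.comp (Computable.snd.comp d3)
  exact partrec₂_isoP e g h m gs hs

/-- Refutation reduces to the halting set through `t`, so the oracle finds the first data that are
not refuted; the parametrization theorem turns these into an index. -/
theorem exists_uniform_turingReducible_zeroJump :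
    ∃ F : ℕ →. ℕ, TuringReducible F zeroJump ∧
      ∀ (e a b g h r : ℕ) (E : Set ℕ) [AddCommGroup E] (A B G H : AddSubgroup E),
        IsInput e a b g h r E A B G H → ∃ i ∈ F (code6 e a b g h r), IsIsoIndex i G H := by
  obtain ⟨t, ht, htR⟩ := exists_reduction_haltingSet rePred_refuted
  obtain ⟨s, hs, hsφ⟩ := exists_computable_index partrec₂_isoOf
  let dec : ℕ → Input × Data := fun n => Denumerable.ofNat _ n
  have hdec : Computable dec := Computable.ofNat (Input × Data)
  have h1 : Nat.RecursiveIn {zeroJump} fun n => Part.some (t (dec n)) >>= zeroJump :=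
    Nat.RecursiveIn.comp (Nat.RecursiveIn.oracle zeroJump rfl)
      (Partrec.nat_iff.1 (ht.comp hdec)).recursiveIn
  -- Minimization looks for a zero, and the value `0` of `zeroJump` means that the data are not
  -- refuted.
  have h2 := Nat.RecursiveIn.rfind h1
  have hid : Nat.RecursiveIn {zeroJump} fun n => Part.some n :=
    Nat.Partrec.some.recursiveIn
  have h3 := Nat.RecursiveIn.comp
    (Partrec.nat_iff.1 (hs.comp hdec)).recursiveIn (Nat.RecursiveIn.pair hid h2)
  refine ⟨_, RecursiveIn.iff_nat.2 h3, ?_⟩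
  intro e a b g h r E _ A B G H hI
  obtain ⟨d₀, hd₀⟩ := exists_not_refuted hI
  -- The nested pairing of `code6` is the standard encoding of a 6-tuple, so one decoding recovers
  -- the input together with the data.
  have hdecp : ∀ n, dec (Nat.pair (code6 e a b g h r) n) =
      ((e, a, b, g, h, r), Denumerable.ofNat Data n) := by
    intro n
    have h4 : Nat.pair (code6 e a b g h r) n =
        Encodable.encode (((e, a, b, g, h, r) : Input), Denumerable.ofNat Data n) := by
      rw [Encodable.encode_prod_val, Denumerable.encode_ofNat]
      rfl
    simp only [dec]
    rw [h4, Denumerable.ofNat_encode]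
  let p : ℕ →. Bool := fun n => (fun m => decide (m = 0)) <$>
    (Part.some (t (dec (Nat.pair (code6 e a b g h r) n))) >>= zeroJump)
  have hp : ∀ n, p n = Part.some (decide
      (charFun haltingSet (t ((e, a, b, g, h, r), Denumerable.ofNat Data n)) = 0)) := by
    intro n
    change ((Part.some _).bind zeroJump).map _ = _
    have h5 : (Part.some (t (dec (Nat.pair (code6 e a b g h r) n)))).bind zeroJump =
      zeroJump (t (dec (Nat.pair (code6 e a b g h r) n))) := Part.bind_some _ _
    rw [h5, zeroJump, Part.map_some, hdecp]
  have hp' : ∀ n, true ∈ p n ↔ ¬ Refuted ((e, a, b, g, h, r), Denumerable.ofNat Data n) := by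
    intro n
    rw [hp, Part.mem_some_iff, eq_comm, decide_eq_true_iff, htR, charFun]
    split_ifs with hn
    · exact iff_of_false (by simp) (not_not.2 hn)
    · exact iff_of_true (by simp) hn
  have hdom : (Nat.rfind p).Dom := by
    refine Nat.rfind_dom.2 ⟨Encodable.encode d₀, (hp' _).2 ?_, fun {n} _ => by rw [hp]; trivial⟩
    rw [Denumerable.ofNat_encode]
    exact hd₀
  obtain ⟨n, hn⟩ := Part.dom_iff_mem.1 hdom
  have hnR := (hp' n).1 (Nat.rfind_spec hn)
  obtain ⟨f, hf⟩ := exists_addEquiv_of_not_refuted hI hnR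
  refine ⟨s (dec (Nat.pair (code6 e a b g h r) n)), ?_, f, fun u v => ?_⟩
  · refine Part.mem_bind_iff.2 ⟨Nat.pair (code6 e a b g h r) n, ?_, Part.mem_some _⟩
    have hn' : n ∈ Nat.rfind fun n => (fun m => decide (m = 0)) <$>
      (Part.some (t (dec (Nat.pair (code6 e a b g h r) n))) >>= zeroJump) := hn
    rw [Part.eq_some_iff.2 hn']
    simp [Seq.seq]
  · rw [hsφ, hdecp]
    exact hf u v

end UpperBound

theorem theorem1p3 :
    (∃ F : ℕ →. ℕ, TuringReducible F zeroJump ∧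
      ∀ (e a b g h r : ℕ) (E : Set ℕ) [AddCommGroup E] (A B G H : AddSubgroup E),
        IsInput e a b g h r E A B G H →
          ∃ i ∈ F (code6 e a b g h r), IsIsoIndex i G H) ∧
    (∀ F : ℕ →. ℕ,
      (∀ (e a b g h r : ℕ) (E : Set ℕ) [AddCommGroup E] (A B G H : AddSubgroup E),
        IsInput e a b g h r E A B G H →
          ∃ i ∈ F (code6 e a b g h r), IsIsoIndexOn i G H) →
      TuringReducible zeroJump F) := ⟨exists_uniform_turingReducible_zeroJump, fun _ hF => zeroJump_turingReducible_of_uniform hF⟩
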